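/- All logarithms are to base 2 and entropies $H$ and divergences $D_{\mathrm{KL}}$ are measured in bits. Let $D, N, M_1, \dots, M_D$ be positive integers, let $p$ be the uniform distribution on $[0, M_1) \times \cdots \times [0, M_D)$, let $\mathbf X$ be a random variable with values in a space $\mathcal X$, and for each $\mathbf x \in \mathcal X$ let $q_{\mathbf x}$ be a probability density on $\mathbb R^D$ (measurable in $(\mathbf x, \mathbf z)$) with $$C = \mathbb E_{\mathbf X}\left[D_{\mathrm{KL}}(q_{\mathbf X} \,\|\, p)\right] < \infty .$$ Let $\mathbf c_{\mathbf x} \in \mathbb R^D$ (measurable in $\mathbf x$) be such that the cell $\mathbf c_{\mathbf x} + [-\tfrac12, \tfrac12)^D$ contains the support of $q_{\mathbf x}$ (up to a Lebesgue null set) and is itself contained in $[0, M_1) \times \cdots \times [0, M_D)$, and let $r_{\mathbf x}$ be the indicator function of this cell, i.e. the density of the uniform distribution on it. Let $S_1, S_2, \dots$ be exponentially distributed with rate $1$ and let $\mathbf U_1, \mathbf U_2, \dots$ be uniformly distributed on $[0,1)^D$, such that $\mathbf X$ and all the $S_n$ and $\mathbf U_n$ are mutually independent. Put $$\mathbf K_n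 = \lfloor \mathbf c_{\mathbf X} - \mathbf U_n \rceil, \qquad \mathbf Z_n = \mathbf K_n + \mathbf U_n, \qquad \tilde T_{N,n} = \sum_{m=1}^n \frac{N}{N-m+1} S_m,$$ where $\lfloor \cdot \rceil$ rounds each coordinate to the nearest integer, and $$N^* = \operatorname*{argmin}_{1 \le n \le N} \tilde T_{N,n} \frac{r_{\mathbf X}(\mathbf Z_n)}{q_{\mathbf X}(\mathbf Z_n)}, \qquad \mathbf K^* = \mathbf K_{N^*},$$ where the ratio is $+\infty$ if $q_{\mathbf X}(\mathbf Z_n) = 0 < r_{\mathbf X}(\mathbf Z_n)$ and the smallest index is taken in case of a tie. Then the transmitted pair satisfies $$H[N^*, \mathbf K^*] < C + \log\Big(C - \sum_i \log M_i + 1\Big) + 4 .$$ -/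

import Mathlib

open MeasureTheory ProbabilityTheory
open scoped ENNReal

noncomputable section

namespace HybridCoding

/-- Shannon entropy, in bits, of a discrete random variable `Y` under `P`
(with values in `[0, ∞]`, so that no summability is presupposed). -/
def entropy {Ω α : Type*} [MeasurableSpace Ω] [Countable α] (P : Measure Ω) (Y : Ω → α) : ℝ≥0∞ :=
  ∑' y : α, ENNReal.ofReal (Real.negMulLog (P.real (Y ⁻¹' {y})) / Real.log 2)

/-- The half-open unit cube `[0, 1)^D`. -/
def unitCube (D : ℕ) : Set (Fin D → ℝ) := Set.univ.pi fun _ => Set.Ico 0 1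

/-- The box `[0, M_1) × ⋯ × [0, M_D)`. -/
def box {D : ℕ} (M : Fin D → ℕ) : Set (Fin D → ℝ) := Set.univ.pi fun i => Set.Ico 0 (M i : ℝ)

/-- The cell `c + [-1/2, 1/2)^D`. -/
def cell {D : ℕ} (c : Fin D → ℝ) : Set (Fin D → ℝ) :=
  Set.univ.pi fun i => Set.Ico (c i - 1 / 2) (c i + 1 / 2)

/-- The uniform distribution on a set of positive finite Lebesgue measure. -/
def uniform {D : ℕ} (A : Set (Fin D → ℝ)) : Measure (Fin D → ℝ) :=
  (volume A)⁻¹ • volume.restrict A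

/-- The density `r_x` of the uniform distribution on the cell with centre `c = c_x`. -/
def proposalDensity {D : ℕ} (c z : Fin D → ℝ) : ℝ≥0∞ := (cell c).indicator 1 z

/-- The Kullback-Leibler divergence `D_KL(q ‖ p)`, in nats, of the distribution with Lebesgue
density `q` from the uniform distribution `p` on the box. -/
def klBox {D : ℕ} (M : Fin D → ℕ) (q : (Fin D → ℝ) → ℝ≥0∞) : ℝ≥0∞ :=
  InformationTheory.klDiv (volume.withDensity q) (uniform (box M))

/-- The quantized value `K = ⌊c - u⌉`, rounded coordinatewise to a nearest integer. -/
def quantized {D : ℕ} (c u : Fin D → ℝ) : Fin D → ℤ := fun i => round (c i - u i)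

/-- The candidate `Z = K + u` of dithered quantization with dither `u`. -/
def candidate {D : ℕ} (c u : Fin D → ℝ) : Fin D → ℝ := fun i => (quantized c u i : ℝ) + u i

/-- `T̃_{N,n} = ∑_{m=1}^n N / (N - m + 1) * S_m`. -/
def orderedTime (N : ℕ) (s : ℕ → ℝ) (n : ℕ) : ℝ :=
  ∑ m ∈ Finset.Icc 1 n, (N : ℝ) / ((N : ℝ) - m + 1) * s m

/-- The score `T̃_{N,n} * r(Z_n) / q(Z_n)` of the `n`-th candidate;
it is `∞` for a candidate in the cell at which `q` vanishes. -/
def score {D : ℕ} (N : ℕ) (c : Fin D → ℝ) (q : (Fin D → ℝ) → ℝ≥0∞)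
    (s : ℕ → ℝ) (u : ℕ → Fin D → ℝ) (n : ℕ) : ℝ≥0∞ :=
  ENNReal.ofReal (orderedTime N s n) *
    (proposalDensity c (candidate c (u n)) / q (candidate c (u n)))

/-- `argmin_{1 ≤ n ≤ N} f n`, where the smallest index is returned in case of a tie. -/
def argmin (N : ℕ) (f : ℕ → ℝ≥0∞) : ℕ :=
  sInf {n : ℕ | n ∈ Finset.Icc 1 N ∧ ∀ m ∈ Finset.Icc 1 N, f n ≤ f m}

/-- The selected index `N* ∈ {1, …, N}`. -/
def selectedIndex {D : ℕ} (N : ℕ) (c : Fin D → ℝ) (q : (Fin D → ℝ) → ℝ≥0∞)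
    (s : ℕ → ℝ) (u : ℕ → Fin D → ℝ) : ℕ :=
  argmin N (score N c q s u)

/-- The transmitted pair `(N*, K*)` with `K* = K_{N*}`. -/
def transmitted {D : ℕ} (N : ℕ) (c : Fin D → ℝ) (q : (Fin D → ℝ) → ℝ≥0∞)
    (s : ℕ → ℝ) (u : ℕ → Fin D → ℝ) : ℕ × (Fin D → ℤ) :=
  (selectedIndex N c q s u, quantized c (u (selectedIndex N c q s u)))

end HybridCoding

end

noncomputable section

namespace HybridCoding

/-! Write `V = ∏ M i`, and let `κ` be the divergence of `q_x` from the uniform law on its cell. The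
density of that law relative to the uniform law on the box is `V`, so `klBox` is `κ + log V`. The
point `K*` takes at most `V` values, so coding it uniformly costs `log V`. By Gibbs' inequality,
coding `N*` with a law proportional to `n^{-(1+s)}` costs at most `log (1 + 1/s) + (1 + s) E log
N*`. Everything therefore rests on `E log N* ≤ E κ + log 2` (in nats), followed by a choice of `s`.

Fix `x`. The dithered candidates are independent and uniform on the cell, so the weight `w = q(Z)`
has mean one. Three ideas bound `E log N*`. (1) Raising the number of candidates from `N` to `K` can
only increase the selected index (`selectedIndex_mono`), so `K` may tend to infinity. (2) Up to the
factor `K`, the times for `K` candidates are Rényi's representation of the order statistics of `K`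
independent exponentials. Functionals symmetric in the marked times can thus be bounded using
unordered independent times (`lintegral_renyiTime_mark_le`), and `N* - 1` becomes the number of
times earlier than the winner's. (3) A winner of weight `a` and time `t` requires the other `k`
candidates to lose, which has probability about `exp (-k t / a)` for small `t / a`. In the limit the
winner's mark has density `w`, and the mean number of earlier times is about `a`. The tangent of
`log` at `1 + a` turns this into `E log N* ≤ ∫ q log (1 + q)` (`lintegral_log_selectedIndex_le`),
and the right side is at most `κ + log 2` (`lintegral_mul_log_one_add_le`). -/

/-! ### Entropy and cross entropy with a power law -/

/-- This is `log x ≤ x - 1` at `x = r / p`, multiplied by `p`. The masses stay on both sides so that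
the inequality can be summed in `[0, ∞]` without subtraction. -/
theorem negMulLog_add_le {p r : ℝ} (hp : 0 < p) (hr : 0 < r) :
    Real.negMulLog p + p ≤ p * (-Real.log r) + r := by
  have h := Real.log_le_sub_one_of_pos (div_pos hr hp)
  rw [Real.log_div hr.ne' hp.ne'] at h
  have h2 := mul_le_mul_of_nonneg_left h hp.le
  have h3 : p * (r / p - 1) = r - p := by field_simp
  rw [h3] at h2
  unfold Real.negMulLog
  linarith

/-- Gibbs' inequality: the entropy is at most the cross entropy relative to a
subprobability vector. -/
theorem entropy_le_crossEntropy {Ω α : Type*} [MeasurableSpace Ω] [Countable α]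
    [MeasurableSpace α] [MeasurableSingletonClass α] (P : Measure Ω) [IsProbabilityMeasure P]
    {Y : Ω → α} (hY : Measurable Y) {r : α → ℝ} (hr0 : ∀ y, 0 ≤ r y)
    (hr_sum : ∑' y, ENNReal.ofReal (r y) ≤ 1) (hr_pos : ∀ᵐ ω ∂P, 0 < r (Y ω)) :
    entropy P Y ≤ ∫⁻ ω, ENNReal.ofReal (-Real.log (r (Y ω)) / Real.log 2) ∂P := by
  have hlog2 : 0 < Real.log 2 := Real.log_pos one_lt_two
  have hr1 : ∀ y, r y ≤ 1 := fun y => by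
    have := (ENNReal.le_tsum y).trans hr_sum
    rwa [← ENNReal.ofReal_one, ENNReal.ofReal_le_ofReal_iff zero_le_one] at this
  have hp1 : ∀ y, P.real (Y ⁻¹' {y}) ≤ 1 := fun y => measureReal_le_one
  have hP : ∑' y, ENNReal.ofReal (P.real (Y ⁻¹' {y})) = 1 := by
    have h1 : ∀ y, ENNReal.ofReal (P.real (Y ⁻¹' {y})) = P.map Y {y} := fun y => by
      rw [ofReal_measureReal, Measure.map_apply hY (measurableSet_singleton y)]
    have : IsProbabilityMeasure (P.map Y) := Measure.isProbabilityMeasure_map hY.aemeasurable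
    have h2 : ∫⁻ _, 1 ∂(P.map Y) = 1 := by simp
    rw [lintegral_countable'] at h2
    simpa [h1] using h2
  have hI : ∫⁻ ω, ENNReal.ofReal (-Real.log (r (Y ω)) / Real.log 2) ∂P
      = ∑' y, ENNReal.ofReal (P.real (Y ⁻¹' {y}) * (-Real.log (r y)) / Real.log 2) := by
    have hm : Measurable fun y => ENNReal.ofReal (-Real.log (r y) / Real.log 2) :=
      measurable_of_countable _
    rw [← lintegral_map (f := fun y => ENNReal.ofReal (-Real.log (r y) / Real.log 2)) hm hY,
      lintegral_countable']
    refine tsum_congr fun y => ?_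
    rw [Measure.map_apply hY (measurableSet_singleton y), ← ofReal_measureReal,
      mul_comm, ← ENNReal.ofReal_mul measureReal_nonneg, mul_div_assoc]
  -- The added masses sum to one on the left and to at most one on the right, so they cancel after
  -- summation.
  have hkey : ∀ y, ENNReal.ofReal (Real.negMulLog (P.real (Y ⁻¹' {y})) / Real.log 2)
      + ENNReal.ofReal (P.real (Y ⁻¹' {y})) / ENNReal.ofReal (Real.log 2)
      ≤ ENNReal.ofReal (P.real (Y ⁻¹' {y}) * (-Real.log (r y)) / Real.log 2)
        + ENNReal.ofReal (r y) / ENNReal.ofReal (Real.log 2) := fun y => by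
    have hneg : 0 ≤ -Real.log (r y) := by
      have := Real.log_nonpos (hr0 y) (hr1 y); linarith
    rw [← ENNReal.ofReal_div_of_pos hlog2, ← ENNReal.ofReal_div_of_pos hlog2,
      ← ENNReal.ofReal_add (div_nonneg (Real.negMulLog_nonneg measureReal_nonneg (hp1 y)) hlog2.le)
        (div_nonneg measureReal_nonneg hlog2.le),
      ← ENNReal.ofReal_add (div_nonneg (mul_nonneg measureReal_nonneg hneg) hlog2.le)
        (div_nonneg (hr0 y) hlog2.le), ← add_div, ← add_div]
    refine ENNReal.ofReal_le_ofReal (div_le_div_of_nonneg_right ?_ hlog2.le)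
    rcases (measureReal_nonneg (μ := P) (s := Y ⁻¹' {y})).eq_or_lt with h0 | h0
    · rw [← h0]; simpa using hr0 y
    · refine negMulLog_add_le h0 ?_
      by_contra hcon
      have : P (Y ⁻¹' {y}) = 0 := by
        refine measure_mono_null (fun ω hω => ?_) (ae_iff.1 hr_pos)
        have : Y ω = y := hω
        simpa [this] using hcon
      simp [measureReal_def, this] at h0
  have hsum := ENNReal.tsum_le_tsum hkey
  rw [ENNReal.tsum_add, ENNReal.tsum_add] at hsum
  simp only [div_eq_mul_inv (ENNReal.ofReal _) (ENNReal.ofReal (Real.log 2)),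
    ENNReal.tsum_mul_right, hP] at hsum
  rw [← hI] at hsum
  have hfin : 1 * (ENNReal.ofReal (Real.log 2))⁻¹ ≠ ∞ := by simp [hlog2]
  refine (ENNReal.add_le_add_iff_right hfin).1 (hsum.trans ?_)
  gcongr

/-- `∑_{n ≥ 1} n^{-(1+s)} ≤ 1 + 1/s`, in partial sums. -/
theorem sum_rpow_neg_one_sub_le {s : ℝ} (hs : 0 < s) (n : ℕ) :
    ∑ k ∈ Finset.range (n + 1), ((k : ℝ) + 1) ^ (-(1 + s))
      ≤ 1 + 1 / s - 1 / s * ((n : ℝ) + 1) ^ (-s) := by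
  induction n with
  | zero => simp
  | succ n ih =>
    rw [Finset.sum_range_succ]
    have ha : (0 : ℝ) < (n : ℝ) + 1 := by positivity
    have hb : (0 : ℝ) < (n : ℝ) + 1 + 1 := by positivity
    -- Multiplied by `(n + 2)^{-s}`, this makes the new term telescope: `s (n + 2)^{-(1+s)} ≤ (n +
    -- 1)^{-s} - (n + 2)^{-s}`.
    have h1 : 1 + s / ((n : ℝ) + 2) ≤ (((n : ℝ) + 1) / (n + 1 + 1)) ^ (-s) := by
      rw [Real.rpow_def_of_pos (by positivity)]
      have h2 := Real.log_le_sub_one_of_pos (x := ((n : ℝ) + 1) / (n + 1 + 1)) (by positivity)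
      have h3 : ((n : ℝ) + 1) / (n + 1 + 1) - 1 = -(1 / (n + 2)) := by field_simp; ring
      rw [h3] at h2
      have h4 : s / ((n : ℝ) + 2) ≤ Real.log (((n : ℝ) + 1) / (n + 1 + 1)) * -s := by
        have := mul_le_mul_of_nonneg_right h2 hs.le
        have h5 : s / ((n : ℝ) + 2) = 1 / (n + 2) * s := by ring
        rw [h5]; nlinarith
      have := Real.add_one_le_exp (Real.log (((n : ℝ) + 1) / (n + 1 + 1)) * -s)
      linarith
    rw [Real.div_rpow ha.le hb.le, le_div_iff₀ (Real.rpow_pos_of_pos hb _)] at h1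
    have h6 : ((n : ℝ) + 1 + 1) ^ (-(1 + s)) = ((n : ℝ) + 1 + 1) ^ (-s) / (n + 2) := by
      rw [show -(1 + s) = -s - 1 by ring, Real.rpow_sub_one hb.ne']; congr 1; ring
    push_cast
    rw [h6]
    have h7 : ((n : ℝ) + 1 + 1) ^ (-s) / (n + 2)
        = 1 / s * (s / (n + 2) * ((n : ℝ) + 1 + 1) ^ (-s)) := by field_simp
    have h8 : s / (n + 2) * ((n : ℝ) + 1 + 1) ^ (-s)
        ≤ ((n : ℝ) + 1) ^ (-s) - ((n : ℝ) + 1 + 1) ^ (-s) := by linarith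
    have h9 := mul_le_mul_of_nonneg_left h8 (show 0 ≤ 1 / s by positivity)
    rw [h7]
    linarith

theorem tsum_rpow_neg_one_sub_le {s : ℝ} (hs : 0 < s) :
    ∑' n : ℕ, ENNReal.ofReal (if n = 0 then 0 else (n : ℝ) ^ (-(1 + s)))
      ≤ ENNReal.ofReal (1 + 1 / s) := by
  rw [tsum_eq_zero_add' ENNReal.summable]
  simp only [↓reduceIte, ENNReal.ofReal_zero, zero_add, Nat.add_eq_zero_iff, one_ne_zero,
    and_false, Nat.cast_add, Nat.cast_one]
  refine ENNReal.tsum_le_of_sum_range_le fun n => ?_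
  rw [← ENNReal.ofReal_sum_of_nonneg fun k _ => by positivity]
  refine ENNReal.ofReal_le_ofReal ?_
  have h1 := sum_rpow_neg_one_sub_le hs n
  rw [Finset.sum_range_succ] at h1
  have h2 : (0 : ℝ) ≤ ((n : ℝ) + 1) ^ (-(1 + s)) := by positivity
  have h3 : (0 : ℝ) ≤ 1 / s * ((n : ℝ) + 1) ^ (-s) := by positivity
  linarith

/-- Entropy of a pair of a positive integer and an element of a finite set, bounded by the
expected logarithm of the integer. -/
theorem entropy_le_of_lintegral_log {Ω β : Type*} [MeasurableSpace Ω] [Countable β]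
    [MeasurableSpace β] [MeasurableSingletonClass β] (P : Measure Ω) [IsProbabilityMeasure P]
    {Y : Ω → ℕ × β} (hY : Measurable Y) (hY1 : ∀ ω, 1 ≤ (Y ω).1)
    (B : Finset β) (hB : B.Nonempty) (hYB : ∀ᵐ ω ∂P, (Y ω).2 ∈ B) {s : ℝ} (hs : 0 < s) :
    entropy P Y ≤ ENNReal.ofReal
        ((Real.log B.card + Real.log (1 + 1 / s)) / Real.log 2)
      + ENNReal.ofReal ((1 + s) / Real.log 2) * ∫⁻ ω, ENNReal.ofReal (Real.log (Y ω).1) ∂P := by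
  classical
  have hlog2 : 0 < Real.log 2 := Real.log_pos one_lt_two
  have hcard : (1 : ℝ) ≤ B.card := by exact_mod_cast hB.card_pos
  have hZ : 0 < 1 + 1 / s := by positivity
  -- The reference law is a power law in the integer times the uniform law on `B`. Dividing by `1 +
  -- 1/s`, an upper bound for the power sum, makes it a subprobability.
  set a : ℕ → ℝ := fun n => if n = 0 then 0 else (n : ℝ) ^ (-(1 + s)) with ha
  set b : β → ℝ := fun k => if k ∈ B then 1 else 0 with hb
  have ha0 : ∀ n, 0 ≤ a n := fun n => by simp only [ha]; split_ifs <;> positivity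
  have hb0 : ∀ n, 0 ≤ b n := fun n => by simp only [hb]; split_ifs <;> positivity
  have hYpos : ∀ᵐ ω ∂P, 0 < a (Y ω).1 * b (Y ω).2 / ((1 + 1 / s) * B.card) := by
    filter_upwards [hYB] with ω hω
    have h1 : (0 : ℝ) < (Y ω).1 := by exact_mod_cast hY1 ω
    have h2 : (Y ω).1 ≠ 0 := by have := hY1 ω; omega
    simp only [ha, hb, hω, h2, if_true, if_false]
    positivity
  refine (entropy_le_crossEntropy P hY
    (r := fun y => a y.1 * b y.2 / ((1 + 1 / s) * B.card)) (fun y => by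
      have := ha0 y.1; have := hb0 y.2; positivity) ?_ hYpos).trans ?_
  · have h1 : ∀ y : ℕ × β, ENNReal.ofReal (a y.1 * b y.2 / ((1 + 1 / s) * B.card))
        = ENNReal.ofReal (a y.1) * ENNReal.ofReal (b y.2)
          * (ENNReal.ofReal ((1 + 1 / s) * B.card))⁻¹ := fun y => by
      rw [ENNReal.ofReal_div_of_pos (by positivity), ENNReal.ofReal_mul (ha0 _), div_eq_mul_inv]
    simp_rw [h1]
    rw [ENNReal.tsum_mul_right, ENNReal.tsum_prod (f := fun n k =>
      ENNReal.ofReal (a n) * ENNReal.ofReal (b k))]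
    simp_rw [ENNReal.tsum_mul_left]
    rw [ENNReal.tsum_mul_right]
    have h2 : ∑' k, ENNReal.ofReal (b k) = B.card := by
      rw [tsum_eq_sum (s := B) (fun k hk => by simp [hb, hk])]
      rw [Finset.sum_congr rfl (fun k hk => by simp [hb, hk] : ∀ k ∈ B, _ = (1 : ℝ≥0∞))]
      simp
    rw [h2, ENNReal.ofReal_mul hZ.le, ENNReal.ofReal_natCast, ← div_eq_mul_inv]
    refine ENNReal.div_le_of_le_mul ?_
    rw [one_mul]
    gcongr
    exact tsum_rpow_neg_one_sub_le hs
  · rw [← lintegral_const_mul' _ _ ENNReal.ofReal_ne_top]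
    calc _ ≤ ∫⁻ ω, (ENNReal.ofReal ((Real.log B.card + Real.log (1 + 1 / s)) / Real.log 2)
          + ENNReal.ofReal ((1 + s) / Real.log 2) * ENNReal.ofReal (Real.log (Y ω).1)) ∂P := by
          refine lintegral_mono_ae ?_
          filter_upwards [hYB] with ω hω
          have h1 : (0 : ℝ) < (Y ω).1 := by exact_mod_cast hY1 ω
          have h2 : (Y ω).1 ≠ 0 := by have := hY1 ω; omega
          have h3 : 0 ≤ Real.log (Y ω).1 := Real.log_natCast_nonneg _
          have h4 : 0 ≤ Real.log B.card := Real.log_natCast_nonneg _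
          have h5 : 0 ≤ Real.log (1 + 1 / s) :=
            Real.log_nonneg (by have : 0 < 1 / s := by positivity
                                linarith)
          rw [← ENNReal.ofReal_mul (by positivity), ← ENNReal.ofReal_add (by positivity)
            (by positivity)]
          refine ENNReal.ofReal_le_ofReal (le_of_eq ?_)
          simp only [ha, hb, hω, h2, if_true, if_false]
          rw [Real.log_div (by positivity) (by positivity), mul_one, Real.log_rpow h1,
            Real.log_mul (by positivity) (by positivity)]
          ring
      _ = _ := by rw [lintegral_add_left measurable_const]; simp

/-! ### Dithered quantization -/

theorem measurable_round_real : Measurable (round : ℝ → ℤ) := by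
  have : (round : ℝ → ℤ) = fun x => ⌊x + 1 / 2⌋ := funext fun x => round_eq x
  rw [this]
  exact Int.measurable_floor.comp (measurable_id.add_const _)

/-- The map is the identity modulo 1 and has period 1 in `u`, so one fundamental domain may be
exchanged for another. Half-integers round up, hence it is the identity exactly on `(a - 1/2, a +
1/2]`; this is why the half-open ends are switched. -/
theorem map_round_sub_add (a : ℝ) :
    (volume.restrict (Set.Ico (0 : ℝ) 1)).map (fun u => (round (a - u) : ℝ) + u)
      = volume.restrict (Set.Ico (a - 1 / 2) (a + 1 / 2)) := by
  have hm : Measurable fun u : ℝ => (round (a - u) : ℝ) + u :=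
    ((measurable_of_countable (fun n : ℤ => (n : ℝ))).comp
      (measurable_round_real.comp (measurable_const.sub measurable_id))).add measurable_id
  refine Measure.ext_of_lintegral _ fun f hf => ?_
  rw [lintegral_map hf hm, restrict_Ico_eq_restrict_Ioc, restrict_Ico_eq_restrict_Ioc]
  have h1 := (isAddFundamentalDomain_Ioc one_pos (0 : ℝ)).setLIntegral_eq
    (isAddFundamentalDomain_Ioc one_pos (a - 1 / 2)) (μ := volume)
    (fun u => f ((round (a - u) : ℝ) + u)) (by
      rintro ⟨g, hg⟩ x
      obtain ⟨n, rfl⟩ := AddSubgroup.mem_zmultiples_iff.1 hg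
      have h : a - (n • (1 : ℝ) + x) = a - x - (n : ℝ) := by simp; ring
      change f ((round (a - (n • (1 : ℝ) + x)) : ℝ) + (n • (1 : ℝ) + x)) = _
      rw [h, round_sub_intCast]
      congr 1
      simp
      ring)
  rw [zero_add, show a - 1 / 2 + 1 = a + 1 / 2 by ring] at h1
  rw [h1]
  refine setLIntegral_congr_fun measurableSet_Ioc fun u hu => ?_
  have : round (a - u) = 0 := by
    rw [round_eq, Int.floor_eq_zero_iff]
    constructor <;> [have := hu.2; have := hu.1] <;> linarith
  simp [this]

theorem measurable_quantized {D : ℕ} :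
    Measurable fun y : (Fin D → ℝ) × (Fin D → ℝ) => quantized y.1 y.2 := by
  unfold quantized
  refine measurable_pi_lambda _ fun i => measurable_round_real.comp ?_
  fun_prop

theorem measurable_candidate {D : ℕ} :
    Measurable fun y : (Fin D → ℝ) × (Fin D → ℝ) => candidate y.1 y.2 := by
  unfold candidate
  refine measurable_pi_lambda _ fun i => Measurable.add ?_ (by fun_prop)
  exact (measurable_of_countable (fun n : ℤ => (n : ℝ))).comp
    ((measurable_pi_apply i).comp measurable_quantized)

theorem measurableSet_cell {D : ℕ} (c : Fin D → ℝ) : MeasurableSet (cell c) :=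
  MeasurableSet.univ_pi fun _ => measurableSet_Ico

theorem measurableSet_box {D : ℕ} (M : Fin D → ℕ) : MeasurableSet (box M) :=
  MeasurableSet.univ_pi fun _ => measurableSet_Ico

theorem volume_cell {D : ℕ} (c : Fin D → ℝ) : volume (cell c) = 1 := by
  unfold cell
  rw [volume_pi_pi]
  refine Finset.prod_eq_one fun i _ => ?_
  rw [Real.volume_Ico]; norm_num

theorem volume_box {D : ℕ} (M : Fin D → ℕ) : volume (box M) = ((∏ i, M i : ℕ) : ℝ≥0∞) := by
  unfold box
  rw [volume_pi_pi]
  simp [Real.volume_Ico]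

theorem uniform_unitCube (D : ℕ) : uniform (unitCube D) = volume.restrict (unitCube D) := by
  have : volume (unitCube D) = 1 := by
    unfold unitCube
    rw [volume_pi_pi]
    simp
  simp [uniform, this]

/-- Dithered quantization of a uniform dither is uniform on the cell. -/
theorem map_candidate_uniform {D : ℕ} (c : Fin D → ℝ) :
    (uniform (unitCube D)).map (candidate c) = volume.restrict (cell c) := by
  rw [uniform_unitCube]
  unfold unitCube cell
  rw [volume_pi, Measure.restrict_pi_pi, Measure.restrict_pi_pi]
  simp_rw [← map_round_sub_add]
  rw [← Measure.pi_map_pi]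
  · rfl
  · exact fun i => (((measurable_of_countable (fun n : ℤ => (n : ℝ))).comp
      (measurable_round_real.comp (measurable_const.sub measurable_id))).add
        measurable_id).aemeasurable

theorem ae_candidate_mem_cell {D : ℕ} (c : Fin D → ℝ) :
    ∀ᵐ u ∂(uniform (unitCube D)), candidate c u ∈ cell c := by
  have h : ∀ᵐ z ∂((uniform (unitCube D)).map (candidate c)), z ∈ cell c := by
    rw [map_candidate_uniform]; exact ae_restrict_mem (measurableSet_cell c)
  exact ae_of_ae_map (measurable_candidate.of_uncurry_left (x := c)).aemeasurable h

/-- The lattice points of the box. -/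
def boxPoints {D : ℕ} (M : Fin D → ℕ) : Finset (Fin D → ℤ) :=
  Fintype.piFinset fun i => Finset.Ico 0 (M i : ℤ)

theorem card_boxPoints {D : ℕ} (M : Fin D → ℕ) : (boxPoints M).card = ∏ i, M i := by
  simp [boxPoints]

/-- With the candidate in `[0, M i)` and the dither in `[0, 1)`, each coordinate of their difference
lies strictly between `-1` and `M i`; integrality leaves `M i` values. -/
theorem ae_quantized_mem_boxPoints {D : ℕ} {M : Fin D → ℕ} {c : Fin D → ℝ}
    (hcM : cell c ⊆ box M) :
    ∀ᵐ u ∂(uniform (unitCube D)), quantized c u ∈ boxPoints M := by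
  have hu : ∀ᵐ u ∂(uniform (unitCube D)), u ∈ unitCube D := by
    rw [uniform_unitCube]
    exact ae_restrict_mem (MeasurableSet.univ_pi fun _ => measurableSet_Ico)
  filter_upwards [ae_candidate_mem_cell c, hu] with u h1 h2
  have h3 := hcM h1
  simp only [boxPoints, Fintype.mem_piFinset, Finset.mem_Ico]
  intro i
  have h4 : (0 : ℝ) ≤ quantized c u i + u i ∧ (quantized c u i : ℝ) + u i < M i :=
    h3 i (Set.mem_univ i)
  have h5 : 0 ≤ u i ∧ u i < 1 := h2 i (Set.mem_univ i)
  constructor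
  · have : (-1 : ℝ) < quantized c u i := by linarith
    have : (-1 : ℤ) < quantized c u i := by exact_mod_cast this
    omega
  · have : (quantized c u i : ℝ) < M i := by linarith
    exact_mod_cast this

/-! ### Divergences relative to the box and to the cell -/

/-- The divergence from the uniform distribution on the box, in terms of the one from the uniform
distribution on the cell. -/
theorem klBox_eq {D : ℕ} {M : Fin D → ℕ} (hM : ∀ i, 1 ≤ M i) {q : (Fin D → ℝ) → ℝ≥0∞}
    (hq : Measurable q) (hq_one : ∫⁻ z, q z = 1) {c : Fin D → ℝ}
    (hq_supp : ∀ᵐ z : Fin D → ℝ, z ∉ cell c → q z = 0) (hcM : cell c ⊆ box M) :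
    klBox M q = (∫⁻ z in cell c, ENNReal.ofReal (InformationTheory.klFun (q z).toReal))
      + ENNReal.ofReal (Real.log (∏ i, M i : ℕ)) := by
  set V : ℕ := ∏ i, M i with hV
  have hV1 : 1 ≤ V := Finset.one_le_prod' fun i _ => hM i
  have hVr : (1 : ℝ) ≤ V := by exact_mod_cast hV1
  have hV0 : (V : ℝ≥0∞) ≠ 0 := by exact_mod_cast (by omega : V ≠ 0)
  have hVt : (V : ℝ≥0∞) ≠ ∞ := ENNReal.natCast_ne_top V
  have hbox := volume_box M
  rw [← hV] at hbox
  have hunif : uniform (box M) = (V : ℝ≥0∞)⁻¹ • volume.restrict (box M) := by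
    rw [uniform, hbox]
  have hfin : IsFiniteMeasure (uniform (box M)) := by
    refine ⟨?_⟩
    rw [hunif, Measure.smul_apply, Measure.restrict_apply_univ, hbox, smul_eq_mul,
      ENNReal.inv_mul_cancel hV0 hVt]
    exact ENNReal.one_lt_top
  have hq_box : ∀ᵐ z : Fin D → ℝ, z ∉ box M → q z = 0 := by
    filter_upwards [hq_supp] with z hz hzb using hz fun h => hzb (hcM h)
  have hqt : ∀ᵐ z : Fin D → ℝ, q z < ∞ := ae_lt_top hq (by simp [hq_one])
  have hwd : (volume : Measure (Fin D → ℝ)).withDensity q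
      = (uniform (box M)).withDensity (fun z => (V : ℝ≥0∞) * q z) := by
    refine Measure.ext fun s hs => ?_
    rw [withDensity_apply _ hs, withDensity_apply _ hs, hunif, Measure.restrict_smul,
      lintegral_smul_measure, lintegral_const_mul _ hq, smul_eq_mul, ← mul_assoc,
      ENNReal.inv_mul_cancel hV0 hVt, one_mul, Measure.restrict_restrict hs]
    rw [← lintegral_indicator hs, ← lintegral_indicator (hs.inter (measurableSet_box M))]
    refine lintegral_congr_ae ?_
    filter_upwards [hq_box] with z hz
    by_cases h1 : z ∈ s <;> by_cases h2 : z ∈ box M <;> simp [h1, h2, hz]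
  have hac : (volume : Measure (Fin D → ℝ)).withDensity q ≪ uniform (box M) := by
    rw [hwd]; exact withDensity_absolutelyContinuous _ _
  have hrn : ∀ᵐ z ∂(uniform (box M)),
      ((volume : Measure (Fin D → ℝ)).withDensity q).rnDeriv (uniform (box M)) z
        = (V : ℝ≥0∞) * q z := by
    rw [hwd]; exact Measure.rnDeriv_withDensity _ (hq.const_mul _)
  have hfin' : IsFiniteMeasure ((volume : Measure (Fin D → ℝ)).withDensity q) :=
    isFiniteMeasure_withDensity (by simp [hq_one])
  have hqtb : ∀ᵐ z ∂(volume.restrict (box M)), q z < ∞ := ae_restrict_of_ae hqt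
  -- the relative entropy with respect to Lebesgue measure on the box
  have h1 : klBox M q
      = (V : ℝ≥0∞)⁻¹ * ∫⁻ z in box M, ENNReal.ofReal (InformationTheory.klFun (V * (q z).toReal)) := by
    unfold klBox
    rw [InformationTheory.klDiv_eq_lintegral_klFun_of_ac hac]
    rw [lintegral_congr_ae (g := fun z => ENNReal.ofReal
      (InformationTheory.klFun (V * (q z).toReal))) (by
        filter_upwards [hrn] with z hz
        rw [hz, ENNReal.toReal_mul, ENNReal.toReal_natCast])]
    rw [hunif, lintegral_smul_measure, smul_eq_mul]
  have hqb : ∫⁻ z in box M, q z = 1 := by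
    rw [← hq_one, ← lintegral_indicator (measurableSet_box M)]
    refine lintegral_congr_ae ?_
    filter_upwards [hq_box] with z hz
    by_cases h : z ∈ box M <;> simp [h, hz]
  have hlogV : 0 ≤ Real.log V := Real.log_nonneg hVr
  have hmk : Measurable fun z => ENNReal.ofReal (InformationTheory.klFun (q z).toReal) := by
    fun_prop
  have hmk' : Measurable fun z => ENNReal.ofReal (InformationTheory.klFun (V * (q z).toReal)) := by
    fun_prop
  have h2 : klBox M q + V = (∫⁻ z in box M, ENNReal.ofReal (InformationTheory.klFun (q z).toReal))
      + ENNReal.ofReal (Real.log V) + 1 := by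
    -- For `klFun x = x log x + 1 - x`, the functions `klFun (V x) / V` and `klFun x` differ by `x
    -- log V` and constants.
    have hpt : ∀ᵐ z ∂(volume.restrict (box M)),
        (V : ℝ≥0∞)⁻¹ * ENNReal.ofReal (InformationTheory.klFun (V * (q z).toReal)) + 1
        = ENNReal.ofReal (InformationTheory.klFun (q z).toReal)
          + ENNReal.ofReal (Real.log V) * q z + (V : ℝ≥0∞)⁻¹ := by
      filter_upwards [hqtb] with z hz
      have hx : 0 ≤ (q z).toReal := ENNReal.toReal_nonneg
      set x := (q z).toReal with hxdef
      have hqx : q z = ENNReal.ofReal x := (ENNReal.ofReal_toReal hz.ne).symm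
      have hk1 := InformationTheory.klFun_nonneg hx
      have hk2 := InformationTheory.klFun_nonneg (x := V * x) (by positivity)
      have hVi : (V : ℝ≥0∞)⁻¹ = ENNReal.ofReal ((V : ℝ)⁻¹) := by
        rw [ENNReal.ofReal_inv_of_pos (by linarith), ENNReal.ofReal_natCast]
      rw [hqx, hVi, ← ENNReal.ofReal_mul (by positivity), ← ENNReal.ofReal_mul hlogV,
        ← ENNReal.ofReal_one, ← ENNReal.ofReal_add (by positivity) zero_le_one,
        ← ENNReal.ofReal_add hk1 (by positivity), ← ENNReal.ofReal_add (by positivity)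
        (by positivity)]
      congr 1
      rcases hx.eq_or_lt with h0 | h0
      · rw [← h0]; simp [InformationTheory.klFun]; ring
      · simp only [InformationTheory.klFun]
        rw [Real.log_mul (by positivity) h0.ne']
        field_simp
        ring
    have hint := lintegral_congr_ae hpt
    rw [lintegral_add_right _ measurable_const, lintegral_add_right _ measurable_const,
      lintegral_const_mul _ hmk', ← h1, lintegral_add_right _ (hq.const_mul _),
      lintegral_const_mul _ hq, hqb] at hint
    simpa [hbox, ENNReal.inv_mul_cancel hV0 hVt] using hint
  -- Outside the cell `q` vanishes and `klFun 0 = 1`, so the rest of the box contributes its volume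
  -- `V - 1`.
  have h3 : ∫⁻ z in box M, ENNReal.ofReal (InformationTheory.klFun (q z).toReal)
      = (∫⁻ z in cell c, ENNReal.ofReal (InformationTheory.klFun (q z).toReal))
        + ((V : ℝ≥0∞) - 1) := by
    rw [← lintegral_inter_add_sdiff (μ := volume) _ (box M) (measurableSet_cell c),
      Set.inter_eq_self_of_subset_right hcM]
    congr 1
    have : ∫⁻ z in box M \ cell c, ENNReal.ofReal (InformationTheory.klFun (q z).toReal)
        = ∫⁻ z in box M \ cell c, 1 := by
      refine setLIntegral_congr_fun_ae ((measurableSet_box M).diff (measurableSet_cell c)) ?_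
      filter_upwards [hq_supp] with z hz hz2
      simp [hz hz2.2, InformationTheory.klFun_zero]
    rw [this, setLIntegral_one, measure_sdiff hcM (measurableSet_cell c).nullMeasurableSet
      (by simp [volume_cell]), volume_cell, hbox]
  have hV1' : (V : ℝ≥0∞) - 1 + 1 = V := tsub_add_cancel_of_le (by exact_mod_cast hV1)
  rw [h3] at h2
  refine (ENNReal.add_left_inj hVt).1 (h2.trans ?_)
  rw [add_right_comm _ _ (ENNReal.ofReal _), add_assoc _ ((V : ℝ≥0∞) - 1), hV1']

/-- `∫ q log (1 + q) ≤ ∫ q log q + log 2` for a density `q` on the cell. -/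
theorem lintegral_mul_log_one_add_le {D : ℕ} {q : (Fin D → ℝ) → ℝ≥0∞}
    (hq : Measurable q) (hq_one : ∫⁻ z, q z = 1) (c : Fin D → ℝ) :
    ∫⁻ z in cell c, ENNReal.ofReal ((q z).toReal * Real.log (1 + (q z).toReal))
      ≤ (∫⁻ z in cell c, ENNReal.ofReal (InformationTheory.klFun (q z).toReal))
        + ENNReal.ofReal (Real.log 2) := by
  have hlog2 : 0 < Real.log 2 := Real.log_pos one_lt_two
  have hqt : ∀ᵐ z : Fin D → ℝ, q z < ∞ := ae_lt_top hq (by simp [hq_one])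
  have hqtc : ∀ᵐ z ∂(volume.restrict (cell c)), q z < ∞ := ae_restrict_of_ae hqt
  -- From `log y ≤ y - 1` at `y = (1 + x) / (2 x)`: `x log (1 + x) ≤ x log x + x log 2 + (1 - x) /
  -- 2`. The halves cancel after integration, since the cell has volume one and `q` has mass at most
  -- one on it.
  have hpt : ∀ᵐ z ∂(volume.restrict (cell c)),
      ENNReal.ofReal ((q z).toReal * Real.log (1 + (q z).toReal)) + ENNReal.ofReal (1 / 2)
      ≤ ENNReal.ofReal (InformationTheory.klFun (q z).toReal)
        + ENNReal.ofReal (Real.log 2 + 1 / 2) * q z := by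
    filter_upwards [hqtc] with z hz
    have hx : 0 ≤ (q z).toReal := ENNReal.toReal_nonneg
    set x := (q z).toReal with hxdef
    have hqx : q z = ENNReal.ofReal x := (ENNReal.ofReal_toReal hz.ne).symm
    have hk1 := InformationTheory.klFun_nonneg hx
    have hl : 0 ≤ Real.log (1 + x) := Real.log_nonneg (by linarith)
    rw [hqx, ← ENNReal.ofReal_mul (by positivity), ← ENNReal.ofReal_add (by positivity)
      (by positivity), ← ENNReal.ofReal_add hk1 (by positivity)]
    refine ENNReal.ofReal_le_ofReal ?_
    rcases hx.eq_or_lt with h0 | h0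
    · rw [← h0]; simp [InformationTheory.klFun]; norm_num
    · simp only [InformationTheory.klFun]
      have h1 := Real.log_le_sub_one_of_pos (x := (1 + x) / (2 * x)) (by positivity)
      rw [Real.log_div (by positivity) (by positivity), Real.log_mul two_ne_zero h0.ne'] at h1
      have h2 := mul_le_mul_of_nonneg_left h1 hx
      have h3 : x * ((1 + x) / (2 * x) - 1) = (1 - x) / 2 := by field_simp; ring
      rw [h3] at h2
      linarith
  have hint := lintegral_mono_ae hpt
  rw [lintegral_add_right _ measurable_const, lintegral_add_right _ (hq.const_mul _),
    lintegral_const_mul _ hq, lintegral_const, Measure.restrict_apply_univ, volume_cell,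
    mul_one] at hint
  refine (ENNReal.add_le_add_iff_right (a := ENNReal.ofReal (1 / 2)) ENNReal.ofReal_ne_top).1
    (hint.trans ?_)
  rw [add_assoc, ← ENNReal.ofReal_add hlog2.le (by norm_num)]
  gcongr
  calc _ ≤ ENNReal.ofReal (Real.log 2 + 1 / 2) * ∫⁻ z, q z := by
        gcongr; exact Measure.restrict_le_self
    _ = _ := by rw [hq_one, mul_one]

/-! ### Exponential variables and Rényi's representation -/

theorem lintegral_pi_prod {n : ℕ} (μ : Measure ℝ) [SigmaFinite μ] {f : Fin n → ℝ → ℝ≥0∞}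
    (hf : ∀ i, Measurable (f i)) :
    ∫⁻ x, ∏ i, f i (x i) ∂(Measure.pi fun _ : Fin n => μ) = ∏ i, ∫⁻ x, f i x ∂μ := by
  induction n with
  | zero => simp
  | succ n ih =>
    have h := ((measurePreserving_piFinSuccAbove (fun _ : Fin (n + 1) => μ) 0).symm)
    rw [← h.lintegral_comp (show Measurable fun x : Fin (n + 1) → ℝ => ∏ i, f i (x i) by fun_prop)]
    simp only [MeasurableEquiv.piFinSuccAbove_symm_apply, Fin.prod_univ_succ, Fin.insertNthEquiv,
      Equiv.coe_fn_mk, Fin.insertNth_zero', Fin.cons_zero, Fin.cons_succ]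
    rw [lintegral_prod _ (by fun_prop)]
    simp only
    simp_rw [lintegral_const_mul _ (show Measurable fun y : Fin n → ℝ =>
      ∏ i, f i.succ (y i) by fun_prop), ih fun i => hf i.succ]
    rw [lintegral_mul_const _ (hf 0)]

/-- A density of the exponential distribution that vanishes at the origin. -/
def expDensity (x : ℝ) : ℝ≥0∞ := (Set.Ioi (0 : ℝ)).indicator (fun x => ENNReal.ofReal (Real.exp (-x))) x

theorem measurable_expDensity : Measurable expDensity :=
  Measurable.indicator (by fun_prop) measurableSet_Ioi

theorem expMeasure_one : expMeasure 1 = volume.withDensity expDensity := by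
  refine withDensity_congr_ae ?_
  filter_upwards [compl_mem_ae_iff.2 (measure_singleton (μ := volume) (0 : ℝ))] with x hx
  have hx0 : x ≠ 0 := hx
  change exponentialPDF 1 x = _
  rw [exponentialPDF_eq, expDensity]
  rcases lt_or_gt_of_ne hx0 with h | h
  · simp [h.le, not_le.2 h]
  · simp [h, h.le]

instance : IsProbabilityMeasure (expMeasure 1) := isProbabilityMeasure_expMeasure one_pos

theorem ae_pos_expMeasure_one : ∀ᵐ x ∂(expMeasure 1), 0 < x := by
  rw [expMeasure_one, ae_withDensity_iff measurable_expDensity]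
  refine ae_of_all _ fun x hx => ?_
  by_contra h
  exact hx (by simp [expDensity, h])

theorem pi_expMeasure_one (n : ℕ) : (Measure.pi fun _ : Fin n => expMeasure 1)
    = (volume : Measure (Fin n → ℝ)).withDensity fun x => ∏ i, expDensity (x i) := by
  refine Measure.pi_eq fun s hs => ?_
  rw [withDensity_apply _ (MeasurableSet.univ_pi hs), volume_pi,
    ← lintegral_indicator (MeasurableSet.univ_pi hs)]
  have h : ((Set.univ.pi s).indicator fun x : Fin n → ℝ => ∏ i, expDensity (x i))
      = fun x => ∏ i, (s i).indicator expDensity (x i) := by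
    ext x
    by_cases hx : x ∈ Set.univ.pi s
    · rw [Set.indicator_of_mem hx]
      exact Finset.prod_congr rfl fun i _ => (Set.indicator_of_mem (hx i (Set.mem_univ i)) _).symm
    · rw [Set.indicator_of_notMem hx]
      simp only [Set.mem_pi, Set.mem_univ, true_imp_iff, not_forall] at hx
      obtain ⟨i, hi⟩ := hx
      exact (Finset.prod_eq_zero (Finset.mem_univ i) (Set.indicator_of_notMem hi _)).symm
  rw [h, lintegral_pi_prod _ fun i => measurable_expDensity.indicator (hs i)]
  refine Finset.prod_congr rfl fun i _ => ?_
  rw [expMeasure_one, withDensity_apply _ (hs i), lintegral_indicator (hs i)]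

/-- The partial sums `∑_{m ≤ n} s_m / (K - m)`, which represent the order statistics of `K`
exponential variables. -/
def renyiTime {K : ℕ} (s : Fin K → ℝ) (n : Fin K) : ℝ :=
  ∑ m ∈ Finset.Iic n, s m / ((K : ℝ) - m)

/-- The matrix of `renyiTime`. -/
def renyiMatrix (K : ℕ) : Matrix (Fin K) (Fin K) ℝ :=
  Matrix.of fun n m => if m ≤ n then 1 / ((K : ℝ) - m) else 0

theorem sub_fin_pos {K : ℕ} (m : Fin K) : (0 : ℝ) < (K : ℝ) - m := by
  have : ((m : ℕ) : ℝ) < K := by exact_mod_cast m.2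
  linarith

theorem toLin_renyiMatrix {K : ℕ} (s : Fin K → ℝ) :
    Matrix.toLin' (renyiMatrix K) s = renyiTime s := by
  ext n
  rw [Matrix.toLin'_apply, Matrix.mulVec, dotProduct, renyiTime]
  simp only [renyiMatrix, Matrix.of_apply, ite_mul, zero_mul]
  rw [← Finset.sum_filter]
  refine Finset.sum_congr ?_ fun m _ => by ring
  ext m; simp

theorem measurable_renyiTime {K : ℕ} : Measurable (renyiTime (K := K)) := by
  unfold renyiTime
  fun_prop

theorem prod_sub_fin (K : ℕ) : ∏ m : Fin K, ((K : ℝ) - m) = (K.factorial : ℝ) := by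
  rw [Fin.prod_univ_eq_prod_range (fun m => (K : ℝ) - m) K, ← Finset.prod_range_reflect,
    ← Finset.prod_range_add_one_eq_factorial]
  push_cast
  refine Finset.prod_congr rfl fun m hm => ?_
  have hm' := Finset.mem_range.1 hm
  rw [Nat.cast_sub (by omega), Nat.cast_sub (by omega)]
  push_cast; ring

theorem det_renyiMatrix (K : ℕ) : (renyiMatrix K).det = ((K.factorial : ℝ))⁻¹ := by
  rw [Matrix.det_of_isLowerTriangular]
  · simp [renyiMatrix, prod_sub_fin]
  · intro i j hij
    have : ¬ j ≤ i := not_le.2 hij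
    simp [renyiMatrix, this]

theorem renyiTime_strictMono {K : ℕ} {s : Fin K → ℝ} (hs : ∀ i, 0 < s i) :
    StrictMono (renyiTime s) := by
  intro a b hab
  unfold renyiTime
  refine Finset.sum_lt_sum_of_subset (Finset.Iic_subset_Iic.2 hab.le) (i := b) (by simp)
    (by simp [hab]) (div_pos (hs b) (sub_fin_pos b)) fun j _ _ => (div_pos (hs j) (sub_fin_pos j)).le

theorem renyiTime_pos {K : ℕ} {s : Fin K → ℝ} (hs : ∀ i, 0 < s i) (n : Fin K) :
    0 < renyiTime s n :=
  Finset.sum_pos (fun j _ => div_pos (hs j) (sub_fin_pos j)) ⟨n, by simp⟩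

/-- The spacing `s m / (K - m)` enters the `K - m` sums with `n ≥ m`. -/
theorem sum_renyiTime {K : ℕ} (s : Fin K → ℝ) : ∑ n, renyiTime s n = ∑ m, s m := by
  unfold renyiTime
  rw [Finset.sum_comm' (t' := Finset.univ) (s' := fun m => Finset.Ici m) (by simp)]
  refine Finset.sum_congr rfl fun m _ => ?_
  rw [Finset.sum_const, Fin.card_Ici, nsmul_eq_mul, Nat.cast_sub m.2.le]
  have := (sub_fin_pos m).ne'
  field_simp

/-- On positive vectors the joint density depends only on the sum, which `renyiTime` preserves, and
positive spacings give strictly increasing times. Elsewhere the left side is zero. -/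
theorem prod_expDensity_le {K : ℕ} (s : Fin K → ℝ) :
    ∏ i, expDensity (s i) ≤ {t : Fin K → ℝ | StrictMono t}.indicator
      (fun t => ∏ i, expDensity (t i)) (renyiTime s) := by
  by_cases hs : ∀ i, 0 < s i
  · rw [Set.indicator_of_mem (show renyiTime s ∈ {t | StrictMono t} from renyiTime_strictMono hs)]
    refine le_of_eq ?_
    have h : ∀ t : Fin K → ℝ, (∀ i, 0 < t i) →
        ∏ i, expDensity (t i) = ENNReal.ofReal (Real.exp (-∑ i, t i)) := fun t ht => by
      rw [← Finset.sum_neg_distrib, Real.exp_sum,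
        ENNReal.ofReal_prod_of_nonneg fun i _ => (Real.exp_pos _).le]
      exact Finset.prod_congr rfl fun i _ => by simp [expDensity, ht i]
    rw [h s hs, h _ (renyiTime_pos hs), sum_renyiTime]
  · push Not at hs
    obtain ⟨i, hi⟩ := hs
    rw [Finset.prod_eq_zero (Finset.mem_univ i) (by simp [expDensity, hi])]
    exact zero_le

theorem measurableSet_strictMono (K : ℕ) : MeasurableSet {t : Fin K → ℝ | StrictMono t} := by
  have : {t : Fin K → ℝ | StrictMono t}
      = ⋂ a : Fin K, ⋂ b : Fin K, ⋂ _ : a < b, {t : Fin K → ℝ | t a < t b} := by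
    ext t; simp [StrictMono]
  rw [this]
  exact MeasurableSet.iInter fun a => MeasurableSet.iInter fun b => MeasurableSet.iInter fun _ =>
    measurableSet_lt (measurable_pi_apply a) (measurable_pi_apply b)

/-- Change of variables along the triangular map of determinant `1 / K!`: the Rényi times have
density at most `K!` times the exponential one on increasing vectors. Only this inequality is
needed. -/
theorem lintegral_renyiTime_le {K : ℕ} {f : (Fin K → ℝ) → ℝ≥0∞} (hf : Measurable f) :
    ∫⁻ s, f (renyiTime s) ∂(Measure.pi fun _ : Fin K => expMeasure 1)
      ≤ K.factorial * ∫⁻ t, {t : Fin K → ℝ | StrictMono t}.indicator f t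
          ∂(Measure.pi fun _ : Fin K => expMeasure 1) := by
  have hd : Measurable fun x : Fin K → ℝ => ∏ i, expDensity (x i) :=
    Finset.measurable_fun_prod _ fun i _ => measurable_expDensity.comp (measurable_pi_apply i)
  have hS := measurableSet_strictMono K
  have hfr : Measurable fun s => f (renyiTime s) := hf.comp measurable_renyiTime
  rw [pi_expMeasure_one, lintegral_withDensity_eq_lintegral_mul _ hd hfr,
    lintegral_withDensity_eq_lintegral_mul _ hd (hf.indicator hS)]
  have hdet : (renyiMatrix K).det ≠ 0 := by
    rw [det_renyiMatrix]; positivity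
  have hmap := Real.map_matrix_volume_pi_eq_smul_volume_pi hdet
  rw [det_renyiMatrix, inv_inv, Nat.abs_cast, ENNReal.ofReal_natCast] at hmap
  have hT : (Matrix.toLin' (renyiMatrix K) : (Fin K → ℝ) → Fin K → ℝ) = renyiTime :=
    funext toLin_renyiMatrix
  rw [hT] at hmap
  have hG : Measurable ((fun x : Fin K → ℝ => ∏ i, expDensity (x i))
      * {t : Fin K → ℝ | StrictMono t}.indicator f) := hd.mul (hf.indicator hS)
  have hscale := congrArg (fun μ : Measure (Fin K → ℝ) => ∫⁻ t, ((fun x : Fin K → ℝ =>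
    ∏ i, expDensity (x i)) * {t : Fin K → ℝ | StrictMono t}.indicator f) t ∂μ) hmap
  simp only [lintegral_smul_measure, smul_eq_mul] at hscale
  rw [← hscale, lintegral_map hG measurable_renyiTime]
  refine lintegral_mono fun s => ?_
  simp only [Pi.mul_apply]
  refine (mul_le_mul_left (prod_expDensity_le s) _).trans (le_of_eq ?_)
  by_cases h : renyiTime s ∈ {t : Fin K → ℝ | StrictMono t} <;> simp [h]

/-- At most one permutation sorts `t` strictly, so the `K!` regions of fixed strict order are
disjoint. -/
theorem sum_perm_strictMono_le {K : ℕ} (t : Fin K → ℝ) :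
    ∑ σ : Equiv.Perm (Fin K), {t : Fin K → ℝ | StrictMono t}.indicator (1 : (Fin K → ℝ) → ℝ≥0∞)
      (t ∘ σ) ≤ 1 := by
  classical
  by_cases h : ∃ σ : Equiv.Perm (Fin K), StrictMono (t ∘ σ)
  · obtain ⟨σ, hσ⟩ := h
    rw [Finset.sum_eq_single σ]
    · simp [Set.indicator_of_mem (show t ∘ σ ∈ {t | StrictMono t} from hσ)]
    · intro τ _ hτ
      refine Set.indicator_of_notMem (fun hτ' => hτ ?_) _
      have hτ'' : StrictMono (t ∘ τ) := hτ'
      have he : t ∘ τ = t ∘ σ := (StrictMono.range_inj hτ'' hσ).1 (by simp [Set.range_comp])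
      have ht : Function.Injective t := by
        have := hσ.injective.comp σ.symm.injective
        rwa [Function.comp_assoc, Equiv.self_comp_symm, Function.comp_id] at this
      exact Equiv.ext fun i => ht (congrFun he i)
    · simp
  · push Not at h
    rw [Finset.sum_eq_zero fun σ _ => Set.indicator_of_notMem (h σ) _]
    exact zero_le_one

/-- Symmetric functionals of marked Rényi times are dominated by those of independent marked
exponential times. -/
theorem lintegral_renyiTime_mark_le {E : Type*} [MeasurableSpace E] (ρ : Measure E)
    [IsProbabilityMeasure ρ] {K : ℕ} {G : (Fin K → ℝ × E) → ℝ≥0∞} (hG : Measurable G)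
    (hsymm : ∀ (σ : Equiv.Perm (Fin K)) (y : Fin K → ℝ × E), G (y ∘ σ) = G y) :
    ∫⁻ y, G (fun i => (renyiTime (fun j => (y j).1) i, (y i).2))
        ∂(Measure.pi fun _ : Fin K => (expMeasure 1).prod ρ)
      ≤ ∫⁻ y, G y ∂(Measure.pi fun _ : Fin K => (expMeasure 1).prod ρ) := by
  set SM : Set (Fin K → ℝ) := {t | StrictMono t} with hSM
  have hS : MeasurableSet SM := measurableSet_strictMono K
  have hmp := measurePreserving_arrowProdEquivProdArrow ℝ E (Fin K) (fun _ => expMeasure 1)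
    (fun _ => ρ)
  have hG2 : Measurable fun p : (Fin K → ℝ) × (Fin K → E) => G fun i => (p.1 i, p.2 i) :=
    hG.comp (by fun_prop)
  have hG1 : Measurable fun p : (Fin K → ℝ) × (Fin K → E) =>
      G fun i => (renyiTime p.1 i, p.2 i) := by
    refine hG.comp (measurable_pi_lambda _ fun i => Measurable.prodMk ?_ (by fun_prop))
    exact (measurable_pi_apply i).comp (measurable_renyiTime.comp measurable_fst)
  have hfst : Measurable fun y : Fin K → ℝ × E => fun j => (y j).1 := by fun_prop
  have hI : Measurable fun y : Fin K → ℝ × E =>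
      SM.indicator (1 : (Fin K → ℝ) → ℝ≥0∞) (fun j => (y j).1) :=
    (measurable_one.indicator hS).comp hfst
  calc _ = ∫⁻ p, G (fun i => (renyiTime p.1 i, p.2 i)) ∂((Measure.pi fun _ : Fin K =>
          expMeasure 1).prod (Measure.pi fun _ : Fin K => ρ)) := by
        rw [← hmp.lintegral_comp hG1]; rfl
    _ = ∫⁻ e, ∫⁻ s, G (fun i => (renyiTime s i, e i)) ∂(Measure.pi fun _ : Fin K => expMeasure 1)
          ∂(Measure.pi fun _ : Fin K => ρ) := lintegral_prod_symm' _ hG1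
    _ ≤ ∫⁻ e, K.factorial * ∫⁻ t, SM.indicator 1 t * G (fun i => (t i, e i))
          ∂(Measure.pi fun _ : Fin K => expMeasure 1) ∂(Measure.pi fun _ : Fin K => ρ) := by
        refine lintegral_mono fun e => ?_
        refine (lintegral_renyiTime_le (f := fun t => G (fun i => (t i, e i)))
          (hG.comp (by fun_prop))).trans (le_of_eq ?_)
        congr 1
        refine lintegral_congr fun t => ?_
        by_cases h : t ∈ SM
        · simp only [Set.indicator_of_mem h, Pi.one_apply, one_mul]
          exact Set.indicator_of_mem (s := {t | StrictMono t}) h _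
        · simp only [Set.indicator_of_notMem h, zero_mul]
          exact Set.indicator_of_notMem (s := {t | StrictMono t}) h _
    _ = K.factorial * ∫⁻ y, SM.indicator 1 (fun j => (y j).1) * G y
          ∂(Measure.pi fun _ : Fin K => (expMeasure 1).prod ρ) := by
        have hm : Measurable fun p : (Fin K → ℝ) × (Fin K → E) =>
            SM.indicator (1 : (Fin K → ℝ) → ℝ≥0∞) p.1 * G (fun i => (p.1 i, p.2 i)) :=
          ((measurable_one.indicator hS).comp measurable_fst).mul hG2
        rw [lintegral_const_mul _ hm.lintegral_prod_left', ← lintegral_prod_symm' _ hm,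
          ← hmp.lintegral_comp hm]
        rfl
    -- The factor `K!` is spread over the permutations: the product law is exchangeable and `G` is
    -- symmetric, so each order contributes the same integral.
    _ = ∑ σ : Equiv.Perm (Fin K), ∫⁻ y, SM.indicator 1 ((fun j => (y j).1) ∘ σ) * G y
          ∂(Measure.pi fun _ : Fin K => (expMeasure 1).prod ρ) := by
        have h : ∀ σ : Equiv.Perm (Fin K),
            ∫⁻ y, SM.indicator (1 : (Fin K → ℝ) → ℝ≥0∞) ((fun j => (y j).1) ∘ σ) * G y
              ∂(Measure.pi fun _ : Fin K => (expMeasure 1).prod ρ)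
            = ∫⁻ y, SM.indicator 1 (fun j => (y j).1) * G y
              ∂(Measure.pi fun _ : Fin K => (expMeasure 1).prod ρ) := fun σ => by
          have hp := measurePreserving_arrowCongr' (fun _ : Fin K => (expMeasure 1).prod ρ)
            (fun _ : Fin K => (expMeasure 1).prod ρ) σ.symm (MeasurableEquiv.refl (ℝ × E))
            (fun _ => MeasurePreserving.id _)
          rw [← hp.lintegral_comp (show Measurable fun y : Fin K → ℝ × E => SM.indicator
            (1 : (Fin K → ℝ) → ℝ≥0∞) (fun j => (y j).1) * G y from hI.mul hG)]
          refine lintegral_congr fun y => ?_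
          have : (MeasurableEquiv.arrowCongr' σ.symm (MeasurableEquiv.refl (ℝ × E))) y = y ∘ σ := by
            ext i <;> rfl
          rw [this, hsymm]
          rfl
        rw [Finset.sum_congr rfl fun σ _ => h σ, Finset.sum_const, Finset.card_univ,
          Fintype.card_perm, Fintype.card_fin, nsmul_eq_mul]
    _ = ∫⁻ y, (∑ σ : Equiv.Perm (Fin K), SM.indicator 1 ((fun j => (y j).1) ∘ σ)) * G y
          ∂(Measure.pi fun _ : Fin K => (expMeasure 1).prod ρ) := by
        rw [← lintegral_finsetSum]
        · simp_rw [Finset.sum_mul]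
        · intro σ _
          refine Measurable.mul ?_ hG
          exact (measurable_one.indicator hS).comp
            (measurable_pi_lambda _ fun i => by simp only [Function.comp]; fun_prop)
    _ ≤ _ := by
        refine lintegral_mono fun y => ?_
        calc _ ≤ 1 * G y := by
              gcongr
              exact sum_perm_strictMono_le _
          _ = G y := one_mul _

/-! ### Estimates for the exponential law -/

/-- The density is at most one. Little is lost in the application, where the winning time is of
order `1 / K`. -/
theorem lintegral_expMeasure_le {f : ℝ → ℝ≥0∞} (hf : Measurable f) :
    ∫⁻ t, f t ∂(expMeasure 1) ≤ ∫⁻ t in Set.Ici 0, f t := by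
  rw [expMeasure_one, lintegral_withDensity_eq_lintegral_mul _ measurable_expDensity hf,
    ← lintegral_indicator measurableSet_Ici]
  refine lintegral_mono fun t => ?_
  simp only [Pi.mul_apply, expDensity]
  by_cases h : t ∈ Set.Ioi (0 : ℝ)
  · have h0 : (0 : ℝ) < t := h
    rw [Set.indicator_of_mem h, Set.indicator_of_mem (show t ∈ Set.Ici (0 : ℝ) from h0.le)]
    calc _ ≤ 1 * f t := by
          gcongr
          rw [ENNReal.ofReal_le_one, Real.exp_le_one_iff]; linarith
      _ = f t := one_mul _
  · simp [h]

theorem lintegral_exp_neg_mul_le {l : ℝ} (hl : 0 < l) :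
    ∫⁻ t, ENNReal.ofReal (Real.exp (-(l * t))) ∂(expMeasure 1) ≤ ENNReal.ofReal (1 / l) := by
  have hm : Measurable fun t : ℝ => ENNReal.ofReal (Real.exp (-(l * t))) := by fun_prop
  refine (lintegral_expMeasure_le hm).trans ?_
  have h := lintegral_gammaPDF_eq_one one_pos hl
  rw [← lintegral_indicator measurableSet_Ici]
  calc _ = ∫⁻ t, ENNReal.ofReal (1 / l) * gammaPDF 1 l t := by
        refine lintegral_congr fun t => ?_
        by_cases ht : t ∈ Set.Ici (0 : ℝ)
        · rw [Set.indicator_of_mem ht, gammaPDF, gammaPDFReal, if_pos (Set.mem_Ici.1 ht),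
            ← ENNReal.ofReal_mul (by positivity)]
          congr 1
          simp
          field_simp
        · rw [Set.indicator_of_notMem ht, gammaPDF, gammaPDFReal, if_neg (mt Set.mem_Ici.2 ht)]
          simp
    _ ≤ _ := by rw [lintegral_const_mul _ (show Measurable (gammaPDF 1 l) from
        (measurable_gammaPDFReal 1 l).ennreal_ofReal), h, mul_one]

theorem lintegral_mul_exp_neg_mul_le {l : ℝ} (hl : 0 < l) :
    ∫⁻ t, ENNReal.ofReal t * ENNReal.ofReal (Real.exp (-(l * t))) ∂(expMeasure 1)
      ≤ ENNReal.ofReal (1 / l ^ 2) := by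
  have hm : Measurable fun t : ℝ => ENNReal.ofReal t * ENNReal.ofReal (Real.exp (-(l * t))) := by
    fun_prop
  refine (lintegral_expMeasure_le hm).trans ?_
  have h := lintegral_gammaPDF_eq_one two_pos hl
  rw [← lintegral_indicator measurableSet_Ici]
  calc _ = ∫⁻ t, ENNReal.ofReal (1 / l ^ 2) * gammaPDF 2 l t := by
        refine lintegral_congr fun t => ?_
        by_cases ht : t ∈ Set.Ici (0 : ℝ)
        · have ht0 : (0 : ℝ) ≤ t := ht
          rw [Set.indicator_of_mem ht, gammaPDF, gammaPDFReal, if_pos (Set.mem_Ici.1 ht),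
            ← ENNReal.ofReal_mul ht0, ← ENNReal.ofReal_mul (by positivity), Real.Gamma_two,
            show (2 : ℝ) - 1 = 1 by norm_num, Real.rpow_one, Real.rpow_two]
          congr 1
          field_simp
        · rw [Set.indicator_of_notMem ht, gammaPDF, gammaPDFReal, if_neg (mt Set.mem_Ici.2 ht)]
          simp
    _ ≤ _ := by rw [lintegral_const_mul _ (show Measurable (gammaPDF 2 l) from
        (measurable_gammaPDFReal 2 l).ennreal_ofReal), h, mul_one]

theorem lintegral_id_expMeasure_le : ∫⁻ t, ENNReal.ofReal t ∂(expMeasure 1) ≤ 1 := by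
  rw [expMeasure_one, lintegral_withDensity_eq_lintegral_mul _ measurable_expDensity
    ENNReal.measurable_ofReal]
  have h := lintegral_gammaPDF_eq_one two_pos one_pos
  rw [← h]
  refine lintegral_mono fun t => ?_
  simp only [Pi.mul_apply, expDensity]
  by_cases ht : t ∈ Set.Ioi (0 : ℝ)
  · have ht0 : (0 : ℝ) < t := ht
    rw [Set.indicator_of_mem ht, gammaPDF, gammaPDFReal, if_pos ht0.le,
      ← ENNReal.ofReal_mul (by positivity), Real.Gamma_two,
      show (2 : ℝ) - 1 = 1 by norm_num, Real.rpow_one]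
    refine ENNReal.ofReal_le_ofReal (le_of_eq ?_)
    simp; ring
  · simp [ht]

theorem expMeasure_Ici_le (a : ℝ) :
    expMeasure 1 (Set.Ici a) ≤ ENNReal.ofReal (Real.exp (-a)) := by
  have h1 : expMeasure 1 (Set.Ici a) ≤ ∫⁻ t in Set.Ioi a, ENNReal.ofReal (Real.exp (-t)) := by
    rw [expMeasure_one, withDensity_apply _ measurableSet_Ici, ← restrict_Ioi_eq_restrict_Ici]
    refine lintegral_mono fun t => ?_
    exact Set.indicator_le_self _ (fun t => ENNReal.ofReal (Real.exp (-t))) t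
  refine h1.trans (le_of_eq ?_)
  rw [← ofReal_integral_eq_lintegral_ofReal (integrableOn_exp_neg_Ioi a)
    (ae_of_all _ fun t => (Real.exp_pos _).le), integral_exp_neg_Ioi]

/-- On the positive part of the interval the density is at most `exp (-a)` and the length at most
`b`. Keeping both factors bounds the chance that a rival is early and still loses. -/
theorem expMeasure_Ico_le (a b : ℝ) :
    expMeasure 1 (Set.Ico a b) ≤ ENNReal.ofReal b * ENNReal.ofReal (Real.exp (-a)) := by
  rw [expMeasure_one, withDensity_apply _ measurableSet_Ico]
  calc _ ≤ ∫⁻ t in Set.Ico a b, (Set.Ioi (0 : ℝ)).indicator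
          (fun _ => ENNReal.ofReal (Real.exp (-a))) t := by
        refine setLIntegral_mono (measurable_const.indicator measurableSet_Ioi) fun t ht => ?_
        refine Set.indicator_le_indicator ?_
        exact ENNReal.ofReal_le_ofReal (Real.exp_le_exp.2 (by have := ht.1; linarith))
    _ = ENNReal.ofReal (Real.exp (-a)) * volume (Set.Ioi (0 : ℝ) ∩ Set.Ico a b) := by
        rw [lintegral_indicator_const measurableSet_Ioi, Measure.restrict_apply measurableSet_Ioi]
    _ ≤ ENNReal.ofReal (Real.exp (-a)) * volume (Set.Ioo (0 : ℝ) b) := by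
        gcongr
        exact fun t ht => ⟨ht.1, ht.2.2⟩
    _ = _ := by rw [Real.volume_Ioo, sub_zero, mul_comm]

/-! ### Laplace transform of the weights -/

variable {E : Type*} [MeasurableSpace E]

/-- The Laplace transform of the weight `w` under `ρ`. -/
def laplace (ρ : Measure E) (w : E → ℝ) (v : ℝ) : ℝ≥0∞ :=
  ∫⁻ e, ENNReal.ofReal (Real.exp (-(v * w e))) ∂ρ

theorem laplace_anti (ρ : Measure E) {w : E → ℝ} (hw0 : ∀ e, 0 ≤ w e) {u v : ℝ} (huv : u ≤ v) :
    laplace ρ w v ≤ laplace ρ w u := by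
  refine lintegral_mono fun e => ENNReal.ofReal_le_ofReal (Real.exp_le_exp.2 ?_)
  have := mul_le_mul_of_nonneg_right huv (hw0 e)
  linarith

/-- By convexity, `exp (-(u * w))` lies below the chord between the arguments `0` and `v`. -/
theorem laplace_le_of_le (ρ : Measure E) [IsProbabilityMeasure ρ] {w : E → ℝ}
    (hw : Measurable w) {u v : ℝ} (hu : 0 ≤ u) (hv : 0 < v) (huv : u ≤ v) :
    laplace ρ w u ≤ ENNReal.ofReal (u / v) * laplace ρ w v + ENNReal.ofReal (1 - u / v) := by
  have h1 : u / v ≤ 1 := (div_le_one hv).2 huv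
  have hm : Measurable fun e => ENNReal.ofReal (Real.exp (-(v * w e))) := by fun_prop
  unfold laplace
  calc _ ≤ ∫⁻ e, (ENNReal.ofReal (u / v) * ENNReal.ofReal (Real.exp (-(v * w e)))
          + ENNReal.ofReal (1 - u / v)) ∂ρ := by
        refine lintegral_mono fun e => ?_
        have h0 : 0 ≤ u / v := by positivity
        rw [← ENNReal.ofReal_mul h0, ← ENNReal.ofReal_add (by positivity) (by linarith)]
        refine ENNReal.ofReal_le_ofReal ?_
        have := convexOn_exp.2 (Set.mem_univ (-(v * w e))) (Set.mem_univ 0) h0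
          (show 0 ≤ 1 - u / v by linarith) (by ring)
        simp only [smul_eq_mul, mul_zero, add_zero, Real.exp_zero, mul_one] at this
        refine le_trans (le_of_eq ?_) this
        congr 1; field_simp
    _ = _ := by
        rw [lintegral_add_right _ measurable_const, lintegral_const_mul _ hm]; simp

/-- Near the origin, the Laplace transform of a weight of mean one is at most `exp (-r v)`, for
every `r < 1`. -/
theorem exists_laplace_le (ρ : Measure E) [IsProbabilityMeasure ρ] {w : E → ℝ}
    (hw : Measurable w) (hw0 : ∀ e, 0 ≤ w e) (hw1 : ∫⁻ e, ENNReal.ofReal (w e) ∂ρ = 1)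
    {r : ℝ} (hr0 : 0 < r) (hr1 : r < 1) :
    ∃ v₀ > 0, ∀ v, 0 ≤ v → v ≤ v₀ → laplace ρ w v ≤ ENNReal.ofReal (Real.exp (-(r * v))) := by
  -- These are the difference quotients `(1 - exp (-(v w))) / v` at `v = 1 / (n + 1)`, which tend to
  -- `w`. Fatou's lemma makes one of their means exceed `r`, without any second moment of `w`.
  set f : ℕ → E → ℝ≥0∞ := fun n e =>
    ENNReal.ofReal (((n : ℝ) + 1) * (1 - Real.exp (-(1 / ((n : ℝ) + 1) * w e)))) with hf
  have hlim : ∀ e, Filter.Tendsto (fun n => f n e) Filter.atTop (nhds (ENNReal.ofReal (w e))) := by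
    intro e
    refine (ENNReal.continuous_ofReal.tendsto _).comp ?_
    have hd : HasDerivAt (fun x : ℝ => -Real.exp (-(x * w e))) (w e) 0 := by
      have h := (((hasDerivAt_id (0 : ℝ)).mul_const (w e)).fun_neg.exp).fun_neg
      simpa using h
    have hs := hd.tendsto_slope_zero_right
    have hn : Filter.Tendsto (fun n : ℕ => 1 / ((n : ℝ) + 1)) Filter.atTop (nhdsWithin 0 (Set.Ioi 0)) :=
      tendsto_nhdsWithin_iff.2 ⟨tendsto_one_div_add_atTop_nhds_zero_nat,
        Filter.Eventually.of_forall fun n => by simp only [Set.mem_Ioi]; positivity⟩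
    refine (hs.comp hn).congr fun n => ?_
    simp only [Function.comp_apply, zero_add, zero_mul, neg_zero, Real.exp_zero, smul_eq_mul,
      one_div, inv_inv]
    ring
  have hfm : ∀ n, Measurable (f n) := fun n => by simp only [hf]; fun_prop
  have hfatou : ∫⁻ e, Filter.liminf (fun n => f n e) Filter.atTop ∂ρ
      ≤ Filter.liminf (fun n => ∫⁻ e, f n e ∂ρ) Filter.atTop := lintegral_liminf_le hfm
  have hli : ∀ e, Filter.liminf (fun n => f n e) Filter.atTop = ENNReal.ofReal (w e) :=
    fun e => (hlim e).liminf_eq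
  simp_rw [hli, hw1] at hfatou
  have hlt : ENNReal.ofReal r < Filter.liminf (fun n => ∫⁻ e, f n e ∂ρ) Filter.atTop :=
    lt_of_lt_of_le (by simpa using hr1) hfatou
  obtain ⟨n, hn⟩ := (Filter.eventually_lt_of_lt_liminf hlt).exists
  set v₀ : ℝ := 1 / ((n : ℝ) + 1) with hv₀
  have hv₀pos : 0 < v₀ := by positivity
  have hsum : ENNReal.ofReal v₀ * ∫⁻ e, f n e ∂ρ + laplace ρ w v₀ = 1 := by
    unfold laplace
    rw [← lintegral_const_mul _ (by simp only [hf]; fun_prop), ← lintegral_add_right _ (by fun_prop)]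
    rw [← measure_univ (μ := ρ), ← lintegral_one]
    refine lintegral_congr fun e => ?_
    have h1 : Real.exp (-(v₀ * w e)) ≤ 1 := by
      rw [Real.exp_le_one_iff]; have := hw0 e; have := mul_nonneg hv₀pos.le this; linarith
    simp only [hf]
    rw [← ENNReal.ofReal_mul hv₀pos.le, ← ENNReal.ofReal_add ?_ (Real.exp_pos _).le,
      ← ENNReal.ofReal_one]
    · congr 1
      rw [hv₀]; field_simp; ring
    · have : 0 ≤ 1 - Real.exp (-(v₀ * w e)) := by linarith
      positivity
  have hL1 : laplace ρ w v₀ ≤ 1 := hsum ▸ le_add_self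
  set l := (laplace ρ w v₀).toReal with hl
  have hl' : laplace ρ w v₀ = ENNReal.ofReal l :=
    (ENNReal.ofReal_toReal (ne_top_of_le_ne_top ENNReal.one_ne_top hL1)).symm
  have hl0 : 0 ≤ l := ENNReal.toReal_nonneg
  have hlr : l ≤ 1 - v₀ * r := by
    have h1 : ENNReal.ofReal (v₀ * r + l) ≤ 1 := by
      rw [ENNReal.ofReal_add (by positivity) hl0, ENNReal.ofReal_mul hv₀pos.le, ← hl', ← hsum]
      gcongr
    have := ENNReal.ofReal_le_one.1 h1
    linarith
  -- The chord from `0` to `v₀` lies below `1 - r v`, which is at most `exp (-(r v))`.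
  refine ⟨v₀, hv₀pos, fun v hv hvv => (laplace_le_of_le ρ hw hv hv₀pos hvv).trans ?_⟩
  have h1 : v / v₀ ≤ 1 := (div_le_one hv₀pos).2 hvv
  have h0 : 0 ≤ v / v₀ := by positivity
  rw [hl', ← ENNReal.ofReal_mul h0, ← ENNReal.ofReal_add (by positivity) (by linarith)]
  refine ENNReal.ofReal_le_ofReal ?_
  have h2 := mul_le_mul_of_nonneg_left hlr h0
  have h3 : v / v₀ * (1 - v₀ * r) = v / v₀ - r * v := by field_simp
  have h4 := Real.add_one_le_exp (-(r * v))
  linarith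

/-! ### The winner among independent candidates -/

open Classical in
/-- The sum over the indices `j` of positive weight that minimise `t_j / w_j` of
`g + (number of earlier times) * h`. -/
def winnerSum {K : ℕ} (w : E → ℝ) (g h : E → ℝ≥0∞) (y : Fin K → ℝ × E) : ℝ≥0∞ :=
  ∑ j, if 0 < w (y j).2 ∧ ∀ i, (y j).1 * w (y i).2 ≤ (y i).1 * w (y j).2 then
    g (y j).2 + (∑ i, if (y i).1 < (y j).1 then 1 else 0) * h (y j).2 else 0

theorem measurable_winnerTerm {K : ℕ} {w : E → ℝ} (hw : Measurable w) {g h : E → ℝ≥0∞}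
    (hg : Measurable g) (hh : Measurable h) (j : Fin K)
    [∀ y : Fin K → ℝ × E, Decidable (0 < w (y j).2 ∧
      ∀ i, (y j).1 * w (y i).2 ≤ (y i).1 * w (y j).2)]
    [∀ (y : Fin K → ℝ × E) (i : Fin K), Decidable ((y i).1 < (y j).1)] :
    Measurable fun y : Fin K → ℝ × E =>
      if 0 < w (y j).2 ∧ ∀ i, (y j).1 * w (y i).2 ≤ (y i).1 * w (y j).2 then
        g (y j).2 + (∑ i, if (y i).1 < (y j).1 then (1 : ℝ≥0∞) else 0) * h (y j).2 else 0 := by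
  have hwi : ∀ i : Fin K, Measurable fun y : Fin K → ℝ × E => w (y i).2 := fun i => by fun_prop
  have hti : ∀ i : Fin K, Measurable fun y : Fin K → ℝ × E => (y i).1 := fun i => by fun_prop
  refine Measurable.ite ?_ ?_ measurable_const
  · refine MeasurableSet.inter (measurableSet_lt measurable_const (hwi j)) ?_
    have : {y : Fin K → ℝ × E | ∀ i, (y j).1 * w (y i).2 ≤ (y i).1 * w (y j).2}
        = ⋂ i, {y | (y j).1 * w (y i).2 ≤ (y i).1 * w (y j).2} := by ext; simp
    change MeasurableSet {y : Fin K → ℝ × E | ∀ i, (y j).1 * w (y i).2 ≤ (y i).1 * w (y j).2}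
    rw [this]
    exact MeasurableSet.iInter fun i =>
      measurableSet_le ((hti j).mul (hwi i)) ((hti i).mul (hwi j))
  · refine Measurable.add (by fun_prop) (Measurable.mul ?_ (by fun_prop))
    exact Finset.measurable_fun_sum _ fun i _ =>
      Measurable.ite (measurableSet_lt (hti i) (hti j)) measurable_const measurable_const

theorem measurable_winnerSum {K : ℕ} {w : E → ℝ} (hw : Measurable w) {g h : E → ℝ≥0∞}
    (hg : Measurable g) (hh : Measurable h) :
    Measurable (winnerSum (K := K) w g h) :=
  Finset.measurable_fun_sum _ fun j _ => measurable_winnerTerm hw hg hh j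

/-- All tied winners are counted and the rank is a number of earlier times, so labels play no role.
This symmetry is what allows ordered times to be replaced by independent ones. -/
theorem winnerSum_comp_perm {F : Type*} {K : ℕ} (w : F → ℝ) (g h : F → ℝ≥0∞)
    (σ : Equiv.Perm (Fin K)) (y : Fin K → ℝ × F) : winnerSum w g h (y ∘ σ) = winnerSum w g h y := by
  classical
  unfold winnerSum
  refine Eq.trans ?_ (Equiv.sum_comp σ _)
  refine Finset.sum_congr rfl fun j _ => ?_
  have h1 : (∀ i, (y (σ j)).1 * w (y i).2 ≤ (y i).1 * w (y (σ j)).2) ↔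
      ∀ i, ((y ∘ σ) j).1 * w ((y ∘ σ) i).2 ≤ ((y ∘ σ) i).1 * w ((y ∘ σ) j).2 :=
    ⟨fun H i => H (σ i), fun H i => by simpa using H (σ.symm i)⟩
  have h2 : (∑ i, if (y i).1 < (y (σ j)).1 then (1 : ℝ≥0∞) else 0)
      = ∑ i, if ((y ∘ σ) i).1 < ((y ∘ σ) j).1 then 1 else 0 :=
    (Equiv.sum_comp σ fun i => if (y i).1 < (y (σ j)).1 then (1 : ℝ≥0∞) else 0).symm
  simp only [h1, h2, Function.comp_apply]

/-- The candidates that do not beat a candidate of time `t` and weight `a`. -/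
def losers (w : E → ℝ) (t a : ℝ) : Set (ℝ × E) := {z | t * w z.2 ≤ z.1 * a}

theorem measurableSet_losers {w : E → ℝ} (hw : Measurable w) (t a : ℝ) :
    MeasurableSet (losers w t a) :=
  measurableSet_le (by fun_prop) (by fun_prop)

/-- Given the mark `e`, losing means that the time is at least `(t / a) * w e`, which has
probability at most `exp (-(t / a) * w e)`. -/
theorem measure_losers_le (ρ : Measure E) [IsProbabilityMeasure ρ] {w : E → ℝ} (hw : Measurable w)
    {t a : ℝ} (ha : 0 < a) :
    (expMeasure 1).prod ρ (losers w t a) ≤ laplace ρ w (t / a) := by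
  rw [Measure.prod_apply_symm (measurableSet_losers hw t a)]
  refine lintegral_mono fun e => ?_
  refine le_trans (measure_mono ?_) (expMeasure_Ici_le (t / a * w e))
  intro s hs
  have hs' : t * w e ≤ s * a := hs
  rw [Set.mem_Ici, div_mul_eq_mul_div, div_le_iff₀ ha]
  exact hs'

theorem measure_losers_inter_le (ρ : Measure E) [IsProbabilityMeasure ρ] {w : E → ℝ}
    (hw : Measurable w) {t a : ℝ} (ha : 0 < a) :
    (expMeasure 1).prod ρ (losers w t a ∩ {z | z.1 < t})
      ≤ ENNReal.ofReal t * laplace ρ w (t / a) := by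
  have hm : MeasurableSet (losers w t a ∩ {z | z.1 < t}) :=
    (measurableSet_losers hw t a).inter (measurableSet_lt measurable_fst measurable_const)
  unfold laplace
  rw [Measure.prod_apply_symm hm, ← lintegral_const_mul _ (by fun_prop)]
  refine lintegral_mono fun e => ?_
  refine le_trans (measure_mono ?_) (expMeasure_Ico_le (t / a * w e) t)
  intro s hs
  have hs' : t * w e ≤ s * a := hs.1
  refine ⟨?_, hs.2⟩
  rw [div_mul_eq_mul_div, div_le_iff₀ ha]
  exact hs'

/-- The rivals are independent, so both "all lose" and "all lose and rival `i` is early" are product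
events. The early factor is still at most `t` times the Laplace transform, so the full power `k`
survives in both. -/
theorem lintegral_losers_le (ρ : Measure E) [IsProbabilityMeasure ρ] {w : E → ℝ}
    (hw : Measurable w) {t a : ℝ} (ha : 0 < a) (k : ℕ) (G H : ℝ≥0∞)
    [∀ z : Fin k → ℝ × E, Decidable (∀ i, z i ∈ losers w t a)]
    [∀ (z : Fin k → ℝ × E) (i : Fin k), Decidable ((z i).1 < t)] :
    ∫⁻ z, (if ∀ i, z i ∈ losers w t a then
        G + (∑ i, if (z i).1 < t then (1 : ℝ≥0∞) else 0) * H else 0)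
        ∂(Measure.pi fun _ : Fin k => (expMeasure 1).prod ρ)
      ≤ (G + k * ENNReal.ofReal t * H) * laplace ρ w (t / a) ^ k := by
  obtain ⟨A, hA⟩ : ∃ A, A = losers w t a := ⟨_, rfl⟩
  set B := A ∩ {z | z.1 < t} with hB
  have hAm : MeasurableSet A := hA ▸ measurableSet_losers hw t a
  have hBm : MeasurableSet B := hAm.inter (measurableSet_lt measurable_fst measurable_const)
  have hC : ∀ i i' : Fin k, MeasurableSet (if i' = i then B else A) := fun i i' => by
    split_ifs <;> assumption
  have hpA := measure_losers_le ρ hw (t := t) ha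
  have hpB := measure_losers_inter_le ρ hw (t := t) ha
  rw [← hA] at hpA
  rw [← hA, ← hB] at hpB
  set p := laplace ρ w (t / a) with hp
  set ν := (expMeasure 1).prod ρ with hν
  have hpt : ∀ z : Fin k → ℝ × E, (if ∀ i, z i ∈ losers w t a then
        G + (∑ i, if (z i).1 < t then (1 : ℝ≥0∞) else 0) * H else 0)
      = (Set.univ.pi fun _ => A).indicator (fun _ => G) z
        + ∑ i, (Set.univ.pi fun i' => if i' = i then B else A).indicator (fun _ => H) z := by
    intro z
    by_cases hz : ∀ i, z i ∈ losers w t a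
    · rw [if_pos hz]
      rw [← hA] at hz
      rw [Set.indicator_of_mem (show z ∈ Set.univ.pi fun _ => A from fun i _ => hz i),
        Finset.sum_mul]
      congr 1
      refine Finset.sum_congr rfl fun i _ => ?_
      by_cases hi : (z i).1 < t
      · rw [if_pos hi, one_mul, Set.indicator_of_mem]
        intro i' _
        dsimp only
        split_ifs with h
        · subst h; exact ⟨hz _, hi⟩
        · exact hz i'
      · rw [if_neg hi, zero_mul, Set.indicator_of_notMem]
        intro hcon
        have := (Set.mem_univ_pi.1 hcon) i
        rw [if_pos rfl] at this
        exact hi this.2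
    · rw [if_neg hz]
      rw [← hA] at hz
      rw [Set.indicator_of_notMem (fun hcon => hz fun i =>
        (Set.mem_univ_pi.1 hcon) i),
        zero_add, Finset.sum_eq_zero]
      intro i _
      refine Set.indicator_of_notMem (fun hcon => hz fun i' => ?_) _
      have := (Set.mem_univ_pi.1 hcon) i'
      split_ifs at this
      · exact this.1
      · exact this
  rw [lintegral_congr hpt]
  rw [lintegral_add_left (measurable_const.indicator (MeasurableSet.univ_pi fun _ => hAm)),
    lintegral_finsetSum _ fun i _ => measurable_const.indicator (MeasurableSet.univ_pi (hC i)),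
    lintegral_indicator_const (MeasurableSet.univ_pi fun _ => hAm), Measure.pi_pi, add_mul]
  refine add_le_add ?_ ?_
  · rw [Finset.prod_const, Finset.card_univ, Fintype.card_fin]
    gcongr
  · calc _ ≤ ∑ _i : Fin k, H * (ENNReal.ofReal t * p ^ k) := by
          refine Finset.sum_le_sum fun i _ => ?_
          rw [lintegral_indicator_const (MeasurableSet.univ_pi (hC i)), Measure.pi_pi]
          gcongr
          calc _ ≤ ∏ i' : Fin k, (if i' = i then ENNReal.ofReal t else 1) * p := by
                refine Finset.prod_le_prod' fun i' _ => ?_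
                split_ifs
                · exact hpB
                · rw [one_mul]; exact hpA
            _ = _ := by
                rw [Finset.prod_mul_distrib, Finset.prod_const, Finset.card_univ,
                  Fintype.card_fin, Finset.prod_ite_eq' Finset.univ i]
                simp
      _ = _ := by
          rw [Finset.sum_const, Finset.card_univ, Fintype.card_fin, nsmul_eq_mul]; ring

-- Each of the `k + 1` candidates contributes equally to the bound: isolate one as `z` and integrate
-- out its `k` rivals.
open Classical in
theorem lintegral_winnerSum_le (ρ : Measure E) [IsProbabilityMeasure ρ] {w : E → ℝ}
    (hw : Measurable w) {g h : E → ℝ≥0∞} (hg : Measurable g) (hh : Measurable h) (k : ℕ) :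
    ∫⁻ y, winnerSum w g h y ∂(Measure.pi fun _ : Fin (k + 1) => (expMeasure 1).prod ρ)
      ≤ (k + 1) * ∫⁻ z, (if 0 < w z.2 then
          (g z.2 + k * ENNReal.ofReal z.1 * h z.2) * laplace ρ w (z.1 / w z.2) ^ k else 0)
          ∂((expMeasure 1).prod ρ) := by
  set ν := (expMeasure 1).prod ρ with hν
  unfold winnerSum
  rw [lintegral_finsetSum _ fun j _ => measurable_winnerTerm hw hg hh j]
  refine (Finset.sum_le_card_nsmul _ _ _ fun j _ => ?_).trans (le_of_eq (by
    rw [Finset.card_univ, Fintype.card_fin, nsmul_eq_mul]; push_cast; rfl))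
  have hmp := (measurePreserving_piFinSuccAbove (fun _ : Fin (k + 1) => ν) j).symm
  have hm := measurable_winnerTerm hw hg hh j
  rw [← hmp.lintegral_comp hm]
  refine (lintegral_prod _ (hm.comp hmp.measurable).aemeasurable).trans_le ?_
  refine lintegral_mono fun y₀ => ?_
  simp only [Function.comp_apply, MeasurableEquiv.piFinSuccAbove_symm_apply, Fin.insertNthEquiv, Equiv.coe_fn_mk,
    Fin.insertNth_apply_same, Fin.forall_iff_succAbove j, Fin.insertNth_apply_succAbove,
    Fin.sum_univ_succAbove _ j, lt_irrefl, if_false, zero_add, le_refl, true_and]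
  by_cases hy : 0 < w y₀.2
  · simp only [hy, true_and, if_true]
    exact lintegral_losers_le ρ hw hy k (g y₀.2) (h y₀.2)
  · simp [hy]

/-- With `l = r k / a`, the two main terms are bounded by `1 / l` and `k / l ^ 2`. The constant `b`
carries the error from large `t / a`. -/
theorem lintegral_time_le {a r b : ℝ} (ha : 0 < a) (hr : 0 < r) {k : ℕ} (hk : 1 ≤ k)
    (G H : ℝ≥0∞) :
    ∫⁻ t, (G + k * ENNReal.ofReal t * H)
        * (ENNReal.ofReal (Real.exp (-(r * k / a * t))) + ENNReal.ofReal b) ∂(expMeasure 1)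
      ≤ ENNReal.ofReal (1 / (r * k)) * (G * ENNReal.ofReal a)
        + ENNReal.ofReal (1 / (r ^ 2 * k)) * (H * ENNReal.ofReal a ^ 2)
        + ENNReal.ofReal b * (G + k * H) := by
  have hk0 : (0 : ℝ) < k := by exact_mod_cast hk
  set l : ℝ := r * k / a with hl
  have hl0 : 0 < l := by positivity
  have hm1 : Measurable fun t : ℝ => ENNReal.ofReal (Real.exp (-(l * t))) := by fun_prop
  have hm2 : Measurable fun t : ℝ => ENNReal.ofReal t * ENNReal.ofReal (Real.exp (-(l * t))) := by
    fun_prop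
  have h1 := lintegral_exp_neg_mul_le hl0
  have h2 := lintegral_mul_exp_neg_mul_le hl0
  have h3 := lintegral_id_expMeasure_le
  calc _ = ∫⁻ t, (G * ENNReal.ofReal (Real.exp (-(l * t)))
          + k * H * (ENNReal.ofReal t * ENNReal.ofReal (Real.exp (-(l * t))))
          + (ENNReal.ofReal b * G + ENNReal.ofReal b * (k * H) * ENNReal.ofReal t))
          ∂(expMeasure 1) := lintegral_congr fun t => by ring
    _ = G * ∫⁻ t, ENNReal.ofReal (Real.exp (-(l * t))) ∂(expMeasure 1)
        + k * H * ∫⁻ t, ENNReal.ofReal t * ENNReal.ofReal (Real.exp (-(l * t))) ∂(expMeasure 1)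
        + (ENNReal.ofReal b * G + ENNReal.ofReal b * (k * H)
            * ∫⁻ t, ENNReal.ofReal t ∂(expMeasure 1)) := by
        rw [lintegral_add_left (by fun_prop),
          lintegral_add_left (hm1.const_mul _), lintegral_add_left measurable_const,
          lintegral_const_mul _ hm1, lintegral_const_mul _ hm2,
          lintegral_const_mul _ ENNReal.measurable_ofReal]
        simp
    _ ≤ G * ENNReal.ofReal (1 / l) + k * H * ENNReal.ofReal (1 / l ^ 2)
        + (ENNReal.ofReal b * G + ENNReal.ofReal b * (k * H) * 1) := by gcongr
    _ = _ := by
        have e1 : ENNReal.ofReal (1 / l) = ENNReal.ofReal (1 / (r * k)) * ENNReal.ofReal a := by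
          rw [← ENNReal.ofReal_mul (by positivity)]; congr 1; rw [hl]; field_simp
        have e2 : (k : ℝ≥0∞) * ENNReal.ofReal (1 / l ^ 2)
            = ENNReal.ofReal (1 / (r ^ 2 * k)) * ENNReal.ofReal a ^ 2 := by
          rw [← ENNReal.ofReal_natCast, ← ENNReal.ofReal_mul hk0.le, ← ENNReal.ofReal_pow ha.le,
            ← ENNReal.ofReal_mul (by positivity)]
          congr 1; rw [hl]; field_simp
        rw [e1, mul_right_comm (k : ℝ≥0∞) H, e2]
        ring

/-! ### Letting the number of candidates grow -/

/-- Quantitative bound on the expected winner sum, with error terms that vanish as the number of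
candidates grows. -/
theorem exists_lintegral_winnerSum_le (ρ : Measure E) [IsProbabilityMeasure ρ] {w : E → ℝ}
    (hw : Measurable w) (hw0 : ∀ e, 0 ≤ w e) (hw1 : ∫⁻ e, ENNReal.ofReal (w e) ∂ρ = 1)
    {g h : E → ℝ≥0∞} (hg : Measurable g) (hh : Measurable h) {r : ℝ} (hr0 : 0 < r) (hr1 : r < 1) :
    ∃ θ : ℝ, 0 < θ ∧ θ < 1 ∧ ∀ k : ℕ, 1 ≤ k →
      ∫⁻ y, winnerSum w g h y ∂(Measure.pi fun _ : Fin (k + 1) => (expMeasure 1).prod ρ)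
        ≤ ENNReal.ofReal (((k : ℝ) + 1) / (r ^ 2 * k))
            * ∫⁻ e, (g e * ENNReal.ofReal (w e) + h e * ENNReal.ofReal (w e) ^ 2) ∂ρ
          + ENNReal.ofReal (((k : ℝ) + 1) ^ 2 * θ ^ k) * ∫⁻ e, (g e + h e) ∂ρ := by
  classical
  obtain ⟨v₀, hv₀, hlap⟩ := exists_laplace_le ρ hw hw0 hw1 hr0 hr1
  set θ := Real.exp (-(r * v₀)) with hθ
  have hθ0 : 0 < θ := Real.exp_pos _
  refine ⟨θ, hθ0, by rw [hθ, Real.exp_lt_one_iff]; have := mul_pos hr0 hv₀; linarith,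
    fun k hk => (lintegral_winnerSum_le ρ hw hg hh k).trans ?_⟩
  have hk0 : (0 : ℝ) < k := by exact_mod_cast hk
  -- Up to `v₀` the exponential bound applies; beyond it monotonicity leaves at most `θ`, hence the
  -- geometric error `θ ^ k`.
  have hpow : ∀ v, 0 ≤ v → laplace ρ w v ^ k
      ≤ ENNReal.ofReal (Real.exp (-(r * k * v))) + ENNReal.ofReal (θ ^ k) := fun v hv => by
    rcases le_total v v₀ with hvv | hvv
    · refine (pow_le_pow_left' (hlap v hv hvv) k).trans (le_trans (le_of_eq ?_) le_self_add)
      rw [← ENNReal.ofReal_pow (Real.exp_pos _).le, ← Real.exp_nat_mul]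
      congr 2; ring
    · refine (pow_le_pow_left' ((laplace_anti ρ hw0 hvv).trans (hlap v₀ hv₀.le le_rfl)) k).trans
        (le_trans (le_of_eq ?_) le_add_self)
      rw [← ENNReal.ofReal_pow (Real.exp_pos _).le]
  have hwt : ∀ᵐ z ∂((expMeasure 1).prod ρ), 0 < z.1 :=
    Measure.quasiMeasurePreserving_fst.ae ae_pos_expMeasure_one
  set F : ℝ × E → ℝ≥0∞ := fun z => if 0 < w z.2 then
    (g z.2 + k * ENNReal.ofReal z.1 * h z.2)
      * (ENNReal.ofReal (Real.exp (-(r * k / w z.2 * z.1))) + ENNReal.ofReal (θ ^ k)) else 0 with hF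
  have hFm : Measurable F := by
    refine Measurable.ite (measurableSet_lt measurable_const (by fun_prop)) ?_ measurable_const
    fun_prop
  have hint : ∫⁻ z, (if 0 < w z.2 then
          (g z.2 + k * ENNReal.ofReal z.1 * h z.2) * laplace ρ w (z.1 / w z.2) ^ k else 0)
          ∂((expMeasure 1).prod ρ)
      ≤ ENNReal.ofReal (1 / (r ^ 2 * k))
          * ∫⁻ e, (g e * ENNReal.ofReal (w e) + h e * ENNReal.ofReal (w e) ^ 2) ∂ρ
        + ENNReal.ofReal (((k : ℝ) + 1) * θ ^ k) * ∫⁻ e, (g e + h e) ∂ρ := by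
    calc _ ≤ ∫⁻ z, F z ∂((expMeasure 1).prod ρ) := by
          refine lintegral_mono_ae ?_
          filter_upwards [hwt] with z hz
          simp only [hF]
          split_ifs with hz2
          · refine mul_le_mul_right ((hpow _ (by positivity)).trans (le_of_eq ?_)) _
            congr 4; ring
          · exact le_rfl
      _ = ∫⁻ e, ∫⁻ t, F (t, e) ∂(expMeasure 1) ∂ρ := lintegral_prod_symm' _ hFm
      _ ≤ ∫⁻ e, (ENNReal.ofReal (1 / (r ^ 2 * k))
            * (g e * ENNReal.ofReal (w e) + h e * ENNReal.ofReal (w e) ^ 2)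
            + ENNReal.ofReal (((k : ℝ) + 1) * θ ^ k) * (g e + h e)) ∂ρ := by
          refine lintegral_mono fun e => ?_
          simp only [hF]
          by_cases he : 0 < w e
          · simp only [he, if_true]
            refine (lintegral_time_le he hr0 hk (g e) (h e)).trans ?_
            rw [mul_add (ENNReal.ofReal (1 / (r ^ 2 * k)))]
            have e1 : ENNReal.ofReal (1 / (r * k)) ≤ ENNReal.ofReal (1 / (r ^ 2 * k)) := by
              refine ENNReal.ofReal_le_ofReal (one_div_le_one_div_of_le (by positivity) ?_)
              nlinarith [mul_pos hr0 hk0]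
            have e2 : ENNReal.ofReal (θ ^ k) * (g e + k * h e)
                ≤ ENNReal.ofReal (((k : ℝ) + 1) * θ ^ k) * (g e + h e) := by
              rw [ENNReal.ofReal_mul (by positivity), ENNReal.ofReal_add hk0.le zero_le_one,
                ENNReal.ofReal_natCast, ENNReal.ofReal_one]
              calc _ ≤ ENNReal.ofReal (θ ^ k) * ((g e + k * h e) + (k * g e + h e)) := by
                    exact mul_le_mul_right le_self_add _
                _ = _ := by ring
            gcongr
          · simp [he]
      _ = _ := by
          rw [lintegral_add_right _ (by fun_prop), lintegral_const_mul _ (by fun_prop),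
            lintegral_const_mul _ (by fun_prop)]
  refine (mul_le_mul_right hint _).trans (le_of_eq ?_)
  have ek : (k : ℝ≥0∞) + 1 = ENNReal.ofReal ((k : ℝ) + 1) := by
    rw [ENNReal.ofReal_add hk0.le zero_le_one, ENNReal.ofReal_natCast, ENNReal.ofReal_one]
  rw [ek, mul_add, ← mul_assoc, ← mul_assoc, ← ENNReal.ofReal_mul (by positivity),
    ← ENNReal.ofReal_mul (by positivity)]
  congr 3
  · ring
  · ring_nf

/-- A quantity dominated by the winner sums of arbitrarily many candidates is at most the
`w`-weighted mean of `g + w h`. -/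
theorem le_of_forall_le_winnerSum (ρ : Measure E) [IsProbabilityMeasure ρ] {w : E → ℝ}
    (hw : Measurable w) (hw0 : ∀ e, 0 ≤ w e) (hw1 : ∫⁻ e, ENNReal.ofReal (w e) ∂ρ = 1)
    {g h : E → ℝ≥0∞} (hg : Measurable g) (hh : Measurable h)
    (hfin : ∫⁻ e, (g e + h e) ∂ρ ≠ ∞) {x : ℝ≥0∞} {N : ℕ}
    (hx : ∀ K, N ≤ K → x ≤ ρ {e | w e = 0} ^ K
      + ∫⁻ y, winnerSum w g h y ∂(Measure.pi fun _ : Fin K => (expMeasure 1).prod ρ)) :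
    x ≤ ∫⁻ e, (g e * ENNReal.ofReal (w e) + h e * ENNReal.ofReal (w e) ^ 2) ∂ρ := by
  set I := ∫⁻ e, (g e * ENNReal.ofReal (w e) + h e * ENNReal.ofReal (w e) ^ 2) ∂ρ with hI
  have hzero : ρ {e | w e = 0} < 1 := by
    refine lt_of_le_of_ne prob_le_one fun hcon => ?_
    have h1 : ∀ᵐ e ∂ρ, w e = 0 := (prob_compl_eq_zero_iff
      (hw (measurableSet_singleton 0))).2 hcon
    have h2 : ∫⁻ e, ENNReal.ofReal (w e) ∂ρ = 0 := by
      rw [lintegral_congr_ae (g := fun _ => 0) (by filter_upwards [h1] with e he; simp [he])]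
      simp
    rw [h2] at hw1
    exact zero_ne_one hw1
  by_cases hItop : I = ∞
  · rw [hItop]; exact le_top
  -- For fixed `r` the number of candidates tends to infinity, which removes both error terms; only
  -- afterwards does `r` tend to one.
  have hstep : ∀ r : ℝ, 0 < r → r < 1 → x ≤ ENNReal.ofReal (1 / r ^ 2) * I := by
    intro r hr0 hr1
    obtain ⟨θ, hθ0, hθ1, hθ⟩ := exists_lintegral_winnerSum_le ρ hw hw0 hw1 hg hh hr0 hr1
    have ht1 : Filter.Tendsto (fun k : ℕ => ρ {e | w e = 0} ^ (k + 1)) Filter.atTop (nhds 0) :=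
      (ENNReal.tendsto_pow_atTop_nhds_zero_of_lt_one hzero).comp (Filter.tendsto_add_atTop_nat 1)
    have ht2 : Filter.Tendsto (fun k : ℕ => ENNReal.ofReal (((k : ℝ) + 1) / (r ^ 2 * k)) * I)
        Filter.atTop (nhds (ENNReal.ofReal (1 / r ^ 2) * I)) := by
      refine ENNReal.Tendsto.mul_const ((ENNReal.continuous_ofReal.tendsto _).comp ?_)
        (Or.inr hItop)
      have h1 : Filter.Tendsto (fun k : ℕ => 1 / r ^ 2 * (1 + 1 / (k : ℝ))) Filter.atTop
          (nhds (1 / r ^ 2 * (1 + 0))) :=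
        (tendsto_const_nhds.add tendsto_one_div_atTop_nhds_zero_nat).const_mul _
      rw [add_zero, mul_one] at h1
      refine h1.congr' ?_
      filter_upwards [Filter.eventually_ge_atTop 1] with k hk
      have hk0 : (0 : ℝ) < k := by exact_mod_cast hk
      field_simp
    have ht3 : Filter.Tendsto (fun k : ℕ => ENNReal.ofReal (((k : ℝ) + 1) ^ 2 * θ ^ k)
        * ∫⁻ e, (g e + h e) ∂ρ) Filter.atTop (nhds (0 * ∫⁻ e, (g e + h e) ∂ρ)) := by
      refine ENNReal.Tendsto.mul_const ?_ (Or.inr hfin)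
      rw [← ENNReal.ofReal_zero]
      refine (ENNReal.continuous_ofReal.tendsto _).comp ?_
      have h1 := (tendsto_pow_const_mul_const_pow_of_abs_lt_one 2
        (show |θ| < 1 by rwa [abs_of_pos hθ0])).comp (Filter.tendsto_add_atTop_nat 1)
      have h2 := h1.const_mul (1 / θ)
      rw [mul_zero] at h2
      refine h2.congr fun k => ?_
      simp only [Function.comp_apply, pow_succ]
      push_cast
      field_simp
    have ht := ht1.add (ht2.add ht3)
    rw [zero_add, zero_mul, add_zero] at ht
    refine ge_of_tendsto ht ?_
    filter_upwards [Filter.eventually_ge_atTop (N + 1)] with k hk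
    refine (hx (k + 1) (by omega)).trans ?_
    gcongr
    exact hθ k (by omega)
  have hlim : Filter.Tendsto (fun r : ℝ => ENNReal.ofReal (1 / r ^ 2) * I)
      (nhdsWithin 1 (Set.Iio 1)) (nhds (ENNReal.ofReal (1 / 1 ^ 2) * I)) := by
    refine ENNReal.Tendsto.mul_const ((ENNReal.continuous_ofReal.tendsto _).comp ?_)
      (Or.inr hItop)
    refine Filter.Tendsto.mono_left ?_ nhdsWithin_le_nhds
    exact (continuousAt_const.div (continuousAt_id.pow 2) (by norm_num)).tendsto
  rw [one_pow, div_one, ENNReal.ofReal_one, one_mul] at hlim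
  refine ge_of_tendsto hlim ?_
  filter_upwards [Ioo_mem_nhdsLT (show (0 : ℝ) < 1 by norm_num)] with r hr
  exact hstep r hr.1 hr.2

/-! ### The selected index as a function of the number of candidates -/

theorem argmin_spec {N : ℕ} (hN : 1 ≤ N) (f : ℕ → ℝ≥0∞) :
    argmin N f ∈ Finset.Icc 1 N ∧ ∀ m ∈ Finset.Icc 1 N, f (argmin N f) ≤ f m := by
  obtain ⟨n, hn, hmin⟩ := Finset.exists_min_image (Finset.Icc 1 N) f ⟨1, by simp [hN]⟩
  exact Nat.sInf_mem (s := {n : ℕ | n ∈ Finset.Icc 1 N ∧ ∀ m ∈ Finset.Icc 1 N, f n ≤ f m})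
    ⟨n, hn, hmin⟩

/-- Comparison with later indices is enough: were the argmin later than `n`, then `n` would be at
least as good, against the tie rule. -/
theorem argmin_le {N : ℕ} {f : ℕ → ℝ≥0∞} {n : ℕ} (hn : n ∈ Finset.Icc 1 N)
    (h : ∀ m ∈ Finset.Icc 1 N, n ≤ m → f n ≤ f m) : argmin N f ≤ n := by
  have hN : 1 ≤ N := (Finset.mem_Icc.1 hn).1.trans (Finset.mem_Icc.1 hn).2
  by_contra! hlt
  obtain ⟨h1, h2⟩ := argmin_spec hN f
  exact absurd (Nat.sInf_le (s := {n : ℕ | n ∈ Finset.Icc 1 N ∧ ∀ m ∈ Finset.Icc 1 N, f n ≤ f m})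
    ⟨hn, fun m hm => (h _ h1 hlt.le).trans (h2 m hm)⟩) (not_le.2 hlt)

theorem timeScale_pos {N m : ℕ} (hm : m ∈ Finset.Icc 1 N) : 0 < (N : ℝ) / ((N : ℝ) - m + 1) := by
  obtain ⟨h1, h2⟩ := Finset.mem_Icc.1 hm
  have h3 : (m : ℝ) ≤ N := by exact_mod_cast h2
  have h4 : (1 : ℝ) ≤ N := by exact_mod_cast h1.trans h2
  exact div_pos (by linarith) (by linarith)

theorem orderedTime_pos {N : ℕ} {s : ℕ → ℝ} (hs : ∀ m, 0 < s m) {n : ℕ}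
    (hn : n ∈ Finset.Icc 1 N) : 0 < orderedTime N s n := by
  obtain ⟨h1, h2⟩ := Finset.mem_Icc.1 hn
  refine Finset.sum_pos (fun m hm => mul_pos (timeScale_pos ?_) (hs m)) ⟨1, by simp [h1]⟩
  exact Finset.mem_Icc.2 ⟨(Finset.mem_Icc.1 hm).1, (Finset.mem_Icc.1 hm).2.trans h2⟩

/-- The ratio of the times for `K` and for `N ≤ K` candidates is nonincreasing in the index. -/
theorem orderedTime_mul_le {N K : ℕ} (hNK : N ≤ K) {s : ℕ → ℝ} (hs : ∀ m, 0 < s m) {n n' : ℕ}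
    (hn : n ≤ n') (hn' : n' ≤ N) :
    orderedTime N s n * orderedTime K s n' ≤ orderedTime K s n * orderedTime N s n' := by
  induction n', hn using Nat.le_induction with
  | base => rw [mul_comm]
  | succ k hk ih =>
    have ih' := ih (by omega)
    have hsucc : ∀ L : ℕ, orderedTime L s (k + 1)
        = orderedTime L s k + (L : ℝ) / ((L : ℝ) - (k + 1 : ℕ) + 1) * s (k + 1) := fun L => by
      unfold orderedTime
      rw [Finset.sum_Icc_succ_top (by omega)]
    rw [hsucc, hsucc, mul_add, mul_add]
    refine add_le_add ih' ?_
    rw [← mul_assoc, ← mul_assoc]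
    refine mul_le_mul_of_nonneg_right ?_ (hs _).le
    unfold orderedTime
    rw [Finset.sum_mul, Finset.sum_mul]
    refine Finset.sum_le_sum fun m hm => ?_
    obtain ⟨h1, h2⟩ := Finset.mem_Icc.1 hm
    have e1 : (N : ℝ) ≤ K := by exact_mod_cast hNK
    have e2 : (m : ℝ) ≤ k := by exact_mod_cast h2.trans hk
    have e3 : (k : ℝ) + 1 ≤ N := by exact_mod_cast hn'
    push_cast
    have hN0 : (0 : ℝ) ≤ N := Nat.cast_nonneg N
    have hK0 : (0 : ℝ) ≤ K := Nat.cast_nonneg K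
    have d1 : (0 : ℝ) < (N : ℝ) - m + 1 := by linarith
    have d2 : (0 : ℝ) < (K : ℝ) - m + 1 := by linarith
    have d3 : (0 : ℝ) < (N : ℝ) - (k + 1) + 1 := by linarith
    have d4 : (0 : ℝ) < (K : ℝ) - (k + 1) + 1 := by linarith
    -- After clearing denominators this is `(K - N) (k + 1 - m) ≥ 0`.
    have hdiv : (N : ℝ) / ((N : ℝ) - m + 1) * (K / ((K : ℝ) - (k + 1) + 1))
        ≤ (K : ℝ) / ((K : ℝ) - m + 1) * (N / ((N : ℝ) - (k + 1) + 1)) := by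
      rw [div_mul_div_comm, div_mul_div_comm, mul_comm (K : ℝ) N]
      refine div_le_div_of_nonneg_left (by positivity) (by positivity) ?_
      nlinarith [mul_nonneg (sub_nonneg.2 e1) (show (0 : ℝ) ≤ k + 1 - m by linarith)]
    have := mul_le_mul_of_nonneg_right hdiv (hs m).le
    linarith

/-- With more candidates, the selected index can only grow. -/
theorem selectedIndex_mono {D N K : ℕ} (hN : 1 ≤ N) (hNK : N ≤ K) {c : Fin D → ℝ}
    {q : (Fin D → ℝ) → ℝ≥0∞} {s : ℕ → ℝ} (hs : ∀ m, 0 < s m) {u : ℕ → Fin D → ℝ} :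
    selectedIndex N c q s u ≤ selectedIndex K c q s u := by
  unfold selectedIndex
  obtain ⟨h1, h2⟩ := argmin_spec (hN.trans hNK) (score K c q s u)
  set n := argmin K (score K c q s u) with hn
  rcases le_total N n with h | h
  · exact (Finset.mem_Icc.1 (argmin_spec hN _).1).2.trans h
  · have hnN : n ∈ Finset.Icc 1 N := Finset.mem_Icc.2 ⟨(Finset.mem_Icc.1 h1).1, h⟩
    refine argmin_le hnN fun m hm hnm => ?_
    have hmK : m ∈ Finset.Icc 1 K :=
      Finset.mem_Icc.2 ⟨(Finset.mem_Icc.1 hm).1, (Finset.mem_Icc.1 hm).2.trans hNK⟩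
    have h3 := h2 m hmK
    unfold score at h3 ⊢
    set a := proposalDensity c (candidate c (u n)) / q (candidate c (u n))
    set b := proposalDensity c (candidate c (u m)) / q (candidate c (u m))
    have hT := orderedTime_pos hs h1
    have hTN := orderedTime_pos hs hnN
    have hratio := orderedTime_mul_le hNK hs hnm (Finset.mem_Icc.1 hm).2
    have hne : ENNReal.ofReal (orderedTime K s n) ≠ 0 := by simpa using hT
    -- Passing from `K` to `N` candidates stretches the later time `m` by at least as large a factor
    -- as the time `n`, so `n` still beats `m`.
    refine (ENNReal.mul_le_mul_iff_right hne ENNReal.ofReal_ne_top).1 ?_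
    calc _ = ENNReal.ofReal (orderedTime N s n) * (ENNReal.ofReal (orderedTime K s n) * a) := by ring
      _ ≤ ENNReal.ofReal (orderedTime N s n) * (ENNReal.ofReal (orderedTime K s m) * b) := by gcongr
      _ = ENNReal.ofReal (orderedTime N s n * orderedTime K s m) * b := by
          rw [ENNReal.ofReal_mul hTN.le]; ring
      _ ≤ ENNReal.ofReal (orderedTime K s n * orderedTime N s m) * b := by gcongr
      _ = _ := by rw [ENNReal.ofReal_mul hT.le]; ring

/-- The common factor `K` does not affect the argmin. The shift translates indices starting at one
into `Fin K`. -/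
theorem orderedTime_succ_eq {K : ℕ} (s : ℕ → ℝ) (i : Fin K) :
    orderedTime K s (i + 1) = K * renyiTime (fun j : Fin K => s (j + 1)) i := by
  unfold orderedTime renyiTime
  rw [Finset.mul_sum]
  refine (Finset.sum_bij (fun (j : Fin K) _ => (j : ℕ) + 1) ?_ ?_ ?_ ?_).symm
  · intro j hj
    have : (j : ℕ) ≤ i := Fin.le_def.1 (Finset.mem_Iic.1 hj)
    simp; omega
  · intro a _ b _ hab
    exact Fin.ext (by simpa using hab)
  · intro m hm
    obtain ⟨h1, h2⟩ := Finset.mem_Icc.1 hm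
    have := i.2
    refine ⟨⟨m - 1, by omega⟩, ?_, by simp; omega⟩
    rw [Finset.mem_Iic, Fin.le_def]
    simp; omega
  · intro j _
    push_cast
    ring_nf

/-! ### Expected logarithm of the selected index -/

/-- `log N* + 1` is dominated by the winner sum of `K ≥ N` candidates, unless all weights vanish,
in which case it is one. -/
theorem log_selectedIndex_add_one_le {D N K : ℕ} (hN : 1 ≤ N) (hNK : N ≤ K) {c : Fin D → ℝ}
    {q : (Fin D → ℝ) → ℝ≥0∞} {s : ℕ → ℝ} (hs : ∀ m, 0 < s m) {u : ℕ → Fin D → ℝ}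
    (hcell : ∀ m, candidate c (u m) ∈ cell c) (hfin : ∀ m, q (candidate c (u m)) ≠ ∞)
    {w : (Fin D → ℝ) → ℝ} (hw : ∀ v, w v = (q (candidate c v)).toReal) :
    ENNReal.ofReal (Real.log (selectedIndex N c q s u)) + 1
      ≤ {y : Fin K → ℝ × (Fin D → ℝ) | ∀ i, w (y i).2 = 0}.indicator 1
          (fun i => (s (i + 1), u (i + 1)))
        + winnerSum w (fun v => ENNReal.ofReal (Real.log (1 + w v) + 1 / (1 + w v)))
          (fun v => ENNReal.ofReal (1 / (1 + w v)))
          (fun i : Fin K => (renyiTime (fun j : Fin K => s (j + 1)) i, u (i + 1))) := by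
  classical
  have hK : 1 ≤ K := hN.trans hNK
  have hw0 : ∀ v, 0 ≤ w v := fun v => by rw [hw]; exact ENNReal.toReal_nonneg
  have hqw : ∀ m, q (candidate c (u m)) = ENNReal.ofReal (w (u m)) := fun m => by
    rw [hw, ENNReal.ofReal_toReal (hfin m)]
  have hscore : ∀ m, score K c q s u m
      = ENNReal.ofReal (orderedTime K s m) * (1 / ENNReal.ofReal (w (u m))) := fun m => by
    rw [score, hqw, proposalDensity, Set.indicator_of_mem (hcell m), Pi.one_apply]
  have hmono := selectedIndex_mono (q := q) (u := u) (c := c) hN hNK hs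
  have hN1 : 1 ≤ selectedIndex N c q s u :=
    (Finset.mem_Icc.1 (argmin_spec hN (score N c q s u)).1).1
  obtain ⟨h1, h2⟩ := argmin_spec hK (score K c q s u)
  change selectedIndex K c q s u ∈ _ at h1
  change ∀ m ∈ Finset.Icc 1 K, score K c q s u (selectedIndex K c q s u) ≤ _ at h2
  set n := selectedIndex K c q s u with hn
  obtain ⟨hn1, hnK⟩ := Finset.mem_Icc.1 h1
  rcases (hw0 (u n)).eq_or_lt with hwn | hwn
  · have hall : ∀ m ∈ Finset.Icc 1 K, w (u m) = 0 := by
      intro m hm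
      by_contra hcon
      have hpos : 0 < w (u m) := lt_of_le_of_ne (hw0 _) (Ne.symm hcon)
      have h3 := h2 m hm
      have hT : ENNReal.ofReal (orderedTime K s n) ≠ 0 := by simpa using orderedTime_pos hs h1
      rw [hscore, hscore, ← hwn, ENNReal.ofReal_zero, ENNReal.div_zero one_ne_zero,
        ENNReal.mul_top hT, top_le_iff] at h3
      exact ENNReal.mul_ne_top ENNReal.ofReal_ne_top
        (ENNReal.div_ne_top ENNReal.one_ne_top (by simpa using hpos)) h3
    have hn_one : n ≤ 1 := by
      refine argmin_le (Finset.mem_Icc.2 ⟨le_rfl, hK⟩) fun m hm _ => ?_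
      have hT : ENNReal.ofReal (orderedTime K s m) ≠ 0 := by simpa using orderedTime_pos hs hm
      rw [hscore m, hall m hm, ENNReal.ofReal_zero, ENNReal.div_zero one_ne_zero,
        ENNReal.mul_top hT]
      exact le_top
    have hsel : selectedIndex N c q s u = 1 := by omega
    rw [hsel, Set.indicator_of_mem]
    · simp
    · intro i
      exact hall _ (Finset.mem_Icc.2 ⟨by omega, by have := i.2; omega⟩)
  · refine le_add_of_nonneg_of_le zero_le ?_
    set i : Fin K := ⟨n - 1, by omega⟩ with hi
    have hin : (i : ℕ) + 1 = n := by simp only [hi]; omega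
    have hr : ∀ j : Fin K, orderedTime K s (j + 1)
        = K * renyiTime (fun j : Fin K => s (j + 1)) j := orderedTime_succ_eq s
    set τ := renyiTime (fun j : Fin K => s (j + 1)) with hτ
    have hτmono : StrictMono τ := renyiTime_strictMono fun j => hs _
    have hτpos : ∀ j, 0 < τ j := renyiTime_pos fun j => hs _
    have hK0 : (0 : ℝ) < K := by exact_mod_cast hK
    have hwin : 0 < w (u (i + 1)) ∧ ∀ j : Fin K, τ i * w (u (j + 1)) ≤ τ j * w (u (i + 1)) := by
      rw [hin]
      refine ⟨hwn, fun j => ?_⟩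
      rcases (hw0 (u (j + 1))).eq_or_lt with hj | hj
      · rw [← hj, mul_zero]
        exact mul_nonneg (hτpos j).le hwn.le
      · have h3 := h2 (j + 1) (Finset.mem_Icc.2 ⟨by omega, by have := j.2; omega⟩)
        rw [hscore, hscore, ← hin, hr, hr, hin, one_div, one_div,
          ← ENNReal.ofReal_inv_of_pos hwn, ← ENNReal.ofReal_inv_of_pos hj,
          ← ENNReal.ofReal_mul (mul_nonneg hK0.le (hτpos i).le),
          ← ENNReal.ofReal_mul (mul_nonneg hK0.le (hτpos j).le),
          ENNReal.ofReal_le_ofReal_iff (mul_nonneg (mul_nonneg hK0.le (hτpos j).le)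
            (inv_nonneg.2 hj.le)), ← div_eq_mul_inv, ← div_eq_mul_inv,
          div_le_div_iff₀ hwn hj, mul_assoc, mul_assoc] at h3
        exact le_of_mul_le_mul_left h3 hK0
    have hcount : (∑ j : Fin K, if τ j < τ i then (1 : ℝ≥0∞) else 0) = ((n - 1 : ℕ) : ℝ≥0∞) := by
      simp only [hτmono.lt_iff_lt]
      rw [Finset.sum_ite, Finset.sum_const_zero, add_zero, Finset.sum_const, nsmul_eq_mul, mul_one]
      have : (Finset.univ.filter fun j => j < i) = Finset.Iio i := by ext; simp
      rw [this, Fin.card_Iio]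
    unfold winnerSum
    refine le_trans ?_ (Finset.single_le_sum (fun _ _ => zero_le) (Finset.mem_univ i))
    simp only
    rw [if_pos hwin, hcount, hin]
    have hlog : Real.log (selectedIndex N c q s u) ≤ Real.log n :=
      Real.log_le_log (by exact_mod_cast hN1) (by exact_mod_cast hmono)
    have hlog0 : 0 ≤ Real.log (selectedIndex N c q s u) := Real.log_natCast_nonneg _
    set a := w (u n) with ha
    have hla : 0 ≤ Real.log (1 + a) := Real.log_nonneg (by linarith)
    have hn0 : (0 : ℝ) < n := by exact_mod_cast hn1
    rw [← ENNReal.ofReal_natCast, ← ENNReal.ofReal_one, ← ENNReal.ofReal_add hlog0 zero_le_one,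
      ← ENNReal.ofReal_mul (Nat.cast_nonneg _), ← ENNReal.ofReal_add (by positivity)
      (by positivity)]
    refine ENNReal.ofReal_le_ofReal ?_
    -- Tangent of `log` at `1 + a`, the approximate mean rank of a winner of weight `a`: `log n + 1
    -- ≤ log (1 + a) + n / (1 + a)`. Splitting `n` as `1 + (n - 1)` gives the functions `g` and `h`
    -- of the winner sum.
    have ht := Real.log_le_sub_one_of_pos (x := (n : ℝ) / (1 + a)) (by positivity)
    rw [Real.log_div hn0.ne' (by positivity)] at ht
    have hn' : ((n - 1 : ℕ) : ℝ) = n - 1 := by rw [Nat.cast_sub hn1]; simp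
    rw [hn']
    have e : 1 / (1 + a) + ((n : ℝ) - 1) * (1 / (1 + a)) = n / (1 + a) := by ring
    linarith

instance isProbabilityMeasure_uniform_unitCube (D : ℕ) :
    IsProbabilityMeasure (uniform (unitCube D)) := by
  rw [uniform_unitCube]
  refine ⟨?_⟩
  rw [Measure.restrict_apply_univ, unitCube, volume_pi_pi]
  simp

/-- For a fixed target, the expected logarithm of the selected index is at most
`∫ q log (1 + q)`. -/
theorem lintegral_log_selectedIndex_le {Ω : Type*} [MeasurableSpace Ω] (P : Measure Ω)
    [IsProbabilityMeasure P] {D N : ℕ} (hN : 1 ≤ N) {q : (Fin D → ℝ) → ℝ≥0∞} (hq : Measurable q)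
    (hq_one : ∫⁻ z, q z = 1) {c : Fin D → ℝ} (hq_supp : ∀ᵐ z : Fin D → ℝ, z ∉ cell c → q z = 0)
    {S : ℕ → Ω → ℝ} (hS : ∀ n, Measurable (S n)) {U : ℕ → Ω → Fin D → ℝ}
    (hU : ∀ n, Measurable (U n))
    (hlaw : ∀ n, P.map (fun ω => (S n ω, U n ω)) = (expMeasure 1).prod (uniform (unitCube D)))
    (hind : iIndepFun (fun n ω => (S n ω, U n ω)) P) :
    ∫⁻ ω, ENNReal.ofReal (Real.log (selectedIndex N c q (fun n => S n ω) (fun n => U n ω))) ∂P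
      ≤ ∫⁻ z in cell c, ENNReal.ofReal ((q z).toReal * Real.log (1 + (q z).toReal)) := by
  set ρ := uniform (unitCube D) with hρ
  set w : (Fin D → ℝ) → ℝ := fun v => (q (candidate c v)).toReal with hwdef
  have hcand : Measurable (candidate c) := measurable_candidate.of_uncurry_left (x := c)
  have hw : Measurable w := (hq.comp hcand).ennreal_toReal
  have hw0 : ∀ v, 0 ≤ w v := fun v => ENNReal.toReal_nonneg
  have hpush : ∀ f : ℝ → ℝ≥0∞, Measurable f →
      ∫⁻ v, f (w v) ∂ρ = ∫⁻ z in cell c, f (q z).toReal := fun f hf => by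
    have hfq : Measurable fun z => f (q z).toReal := hf.comp hq.ennreal_toReal
    rw [← map_candidate_uniform c, lintegral_map hfq hcand]
  have hqt : ∀ᵐ z : Fin D → ℝ, q z < ∞ := ae_lt_top hq (by simp [hq_one])
  have hw1 : ∫⁻ v, ENNReal.ofReal (w v) ∂ρ = 1 := by
    rw [hpush _ ENNReal.measurable_ofReal, ← hq_one, ← lintegral_indicator (measurableSet_cell c)]
    refine lintegral_congr_ae ?_
    filter_upwards [hq_supp, hqt] with z hz hz2
    by_cases h : z ∈ cell c
    · rw [Set.indicator_of_mem h, ENNReal.ofReal_toReal hz2.ne]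
    · rw [Set.indicator_of_notMem h, hz h]
  set g : (Fin D → ℝ) → ℝ≥0∞ := fun v => ENNReal.ofReal (Real.log (1 + w v) + 1 / (1 + w v))
    with hg
  set h : (Fin D → ℝ) → ℝ≥0∞ := fun v => ENNReal.ofReal (1 / (1 + w v)) with hh
  have hgm : Measurable g := by
    refine ENNReal.measurable_ofReal.comp (Measurable.add ?_ ?_)
    · exact Real.measurable_log.comp (by fun_prop)
    · fun_prop
  have hhm : Measurable h := by fun_prop
  have hfin : ∫⁻ v, (g v + h v) ∂ρ ≠ ∞ := by
    refine ne_top_of_le_ne_top (b := ∫⁻ v, (ENNReal.ofReal (w v) + 2) ∂ρ) ?_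
      (lintegral_mono fun v => ?_)
    · rw [lintegral_add_right _ measurable_const, hw1]
      simp
    · have h0 := hw0 v
      have h1 : 1 / (1 + w v) ≤ 1 := (div_le_one (by linarith)).2 (by linarith)
      have h2 := Real.log_le_sub_one_of_pos (x := 1 + w v) (by linarith)
      have h3 : 0 ≤ Real.log (1 + w v) := Real.log_nonneg (by linarith)
      have h4 : (2 : ℝ≥0∞) = ENNReal.ofReal 2 := by simp
      simp only [hg, hh]
      rw [h4, ← ENNReal.ofReal_add (by positivity) (by positivity),
        ← ENNReal.ofReal_add h0 zero_le_two]
      exact ENNReal.ofReal_le_ofReal (by linarith)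
  -- The terms `w / (1 + w)` and `w ^ 2 / (1 + w)` add up to `w`, whose mean is one. This matches
  -- the `1` added to `log N*`, and the two cancel at the end.
  have hI : ∫⁻ v, (g v * ENNReal.ofReal (w v) + h v * ENNReal.ofReal (w v) ^ 2) ∂ρ
      = (∫⁻ z in cell c, ENNReal.ofReal ((q z).toReal * Real.log (1 + (q z).toReal))) + 1 := by
    rw [← hpush (fun x => ENNReal.ofReal (x * Real.log (1 + x)))
      (ENNReal.measurable_ofReal.comp (measurable_id.mul
        (Real.measurable_log.comp (measurable_const.add measurable_id)))), ← hw1,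
      ← lintegral_add_right _ hw.ennreal_ofReal]
    refine lintegral_congr fun v => ?_
    have h0 := hw0 v
    have h3 : 0 ≤ Real.log (1 + w v) := Real.log_nonneg (by linarith)
    simp only [hg, hh]
    rw [← ENNReal.ofReal_mul (by positivity), ← ENNReal.ofReal_pow h0,
      ← ENNReal.ofReal_mul (by positivity), ← ENNReal.ofReal_add (by positivity) (by positivity),
      ← ENNReal.ofReal_add (by positivity) h0]
    congr 1
    field_simp
    ring
  have hSpos : ∀ᵐ ω ∂P, ∀ n, 0 < S n ω := by
    rw [ae_all_iff]
    intro n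
    have h1 : ∀ᵐ z ∂(P.map fun ω => (S n ω, U n ω)), 0 < z.1 := by
      rw [hlaw]; exact Measure.quasiMeasurePreserving_fst.ae ae_pos_expMeasure_one
    exact ae_of_ae_map ((hS n).prodMk (hU n)).aemeasurable h1
  have hρae : ∀ᵐ v ∂ρ, candidate c v ∈ cell c ∧ q (candidate c v) ≠ ∞ := by
    have h1 : ∀ᵐ z ∂(ρ.map (candidate c)), q z ≠ ∞ := by
      rw [map_candidate_uniform]
      filter_upwards [ae_restrict_of_ae hqt] with z hz using hz.ne
    exact (ae_candidate_mem_cell c).and (ae_of_ae_map hcand.aemeasurable h1)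
  have hUae : ∀ᵐ ω ∂P, ∀ n, candidate c (U n ω) ∈ cell c ∧ q (candidate c (U n ω)) ≠ ∞ := by
    rw [ae_all_iff]
    intro n
    have h1 : ∀ᵐ z ∂(P.map fun ω => (S n ω, U n ω)),
        candidate c z.2 ∈ cell c ∧ q (candidate c z.2) ≠ ∞ := by
      rw [hlaw]; exact Measure.quasiMeasurePreserving_snd.ae hρae
    exact ae_of_ae_map ((hS n).prodMk (hU n)).aemeasurable h1
  have hmain : (∫⁻ ω, ENNReal.ofReal
      (Real.log (selectedIndex N c q (fun n => S n ω) (fun n => U n ω))) ∂P) + 1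
      ≤ (∫⁻ z in cell c, ENNReal.ofReal ((q z).toReal * Real.log (1 + (q z).toReal))) + 1 := by
    rw [← hI]
    refine le_of_forall_le_winnerSum ρ hw hw0 hw1 hgm hhm hfin (N := N) fun K hK => ?_
    set Z : Set (Fin K → ℝ × (Fin D → ℝ)) := {y | ∀ i, w (y i).2 = 0} with hZ
    have hZpi : Z = Set.univ.pi fun _ => Set.univ ×ˢ {v | w v = 0} := by
      ext y; simp [hZ]
    have hw0m : MeasurableSet {v | w v = 0} := hw (measurableSet_singleton 0)
    have hZm : MeasurableSet Z := by
      rw [hZpi]; exact MeasurableSet.univ_pi fun _ => MeasurableSet.univ.prod hw0m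
    set R : (Fin K → ℝ × (Fin D → ℝ)) → Fin K → ℝ × (Fin D → ℝ) :=
      fun y i => (renyiTime (fun j => (y j).1) i, (y i).2) with hR
    have hRm : Measurable R := by
      refine measurable_pi_lambda _ fun i => Measurable.prodMk ?_ (by fun_prop)
      exact (measurable_pi_apply i).comp (measurable_renyiTime.comp (by fun_prop))
    have hWm : Measurable (winnerSum (K := K) w g h) := measurable_winnerSum hw hgm hhm
    have hΦ : Measurable fun y => Z.indicator (1 : (Fin K → ℝ × (Fin D → ℝ)) → ℝ≥0∞) y + winnerSum w g h (R y) :=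
      (measurable_one.indicator hZm).add (hWm.comp hRm)
    have hY : Measurable fun ω (i : Fin K) => (S (i + 1) ω, U (i + 1) ω) :=
      measurable_pi_lambda _ fun i => (hS _).prodMk (hU _)
    have hYlaw : P.map (fun ω (i : Fin K) => (S (i + 1) ω, U (i + 1) ω))
        = Measure.pi fun _ : Fin K => (expMeasure 1).prod ρ := by
      have h1 : iIndepFun (fun (i : Fin K) ω => (S (i + 1) ω, U (i + 1) ω)) P :=
        hind.precomp (g := fun i : Fin K => (i : ℕ) + 1)
          fun a b hab => Fin.ext (by simpa using hab)
      rw [(iIndepFun_iff_map_fun_eq_pi_map fun i => ((hS _).prodMk (hU _)).aemeasurable).1 h1]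
      simp_rw [hlaw]
    calc _ = ∫⁻ ω, (ENNReal.ofReal
            (Real.log (selectedIndex N c q (fun n => S n ω) (fun n => U n ω))) + 1) ∂P := by
          rw [lintegral_add_right _ measurable_const]; simp
      _ ≤ ∫⁻ ω, (Z.indicator (1 : (Fin K → ℝ × (Fin D → ℝ)) → ℝ≥0∞) (fun i : Fin K => (S (i + 1) ω, U (i + 1) ω))
            + winnerSum w g h (R fun i : Fin K => (S (i + 1) ω, U (i + 1) ω))) ∂P := by
          refine lintegral_mono_ae ?_
          filter_upwards [hSpos, hUae] with ω h1 h2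
          exact log_selectedIndex_add_one_le hN hK h1 (fun m => (h2 m).1) (fun m => (h2 m).2)
            fun v => rfl
      _ = ∫⁻ y, (Z.indicator (1 : (Fin K → ℝ × (Fin D → ℝ)) → ℝ≥0∞) y + winnerSum w g h (R y))
            ∂(Measure.pi fun _ : Fin K => (expMeasure 1).prod ρ) := by
          rw [← hYlaw, lintegral_map hΦ hY]
      _ = ρ {v | w v = 0} ^ K + ∫⁻ y, winnerSum w g h (R y)
            ∂(Measure.pi fun _ : Fin K => (expMeasure 1).prod ρ) := by
          rw [lintegral_add_left (measurable_one.indicator hZm), lintegral_indicator_one hZm, hZpi,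
            Measure.pi_pi]
          simp [Measure.prod_prod]
      _ ≤ _ := by
          refine add_le_add_right ?_ _
          exact lintegral_renyiTime_mark_le ρ hWm (winnerSum_comp_perm w g h)
  exact (ENNReal.add_le_add_iff_right ENNReal.one_ne_top).1 hmain

/-! ### Measurability of the transmitted pair -/

theorem measurable_argmin {α : Type*} [MeasurableSpace α] {N : ℕ} (hN : 1 ≤ N)
    {f : ℕ → α → ℝ≥0∞} (hf : ∀ n, Measurable (f n)) :
    Measurable fun a => argmin N fun n => f n a := by
  set Q : ℕ → Set α := fun n => {a | n ∈ Finset.Icc 1 N ∧ ∀ m ∈ Finset.Icc 1 N, f n a ≤ f m a}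
    with hQ
  have hQm : ∀ n, MeasurableSet (Q n) := fun n => by
    have : Q n = {_a : α | n ∈ Finset.Icc 1 N} ∩ ⋂ m ∈ Finset.Icc 1 N, {a | f n a ≤ f m a} := by
      ext a; simp [hQ]
    rw [this]
    refine (MeasurableSet.const _).inter (MeasurableSet.iInter fun m => ?_)
    exact MeasurableSet.iInter fun _ => measurableSet_le (hf n) (hf m)
  refine measurable_of_Iic fun n => ?_
  have : (fun a => argmin N fun n => f n a) ⁻¹' Set.Iic n = ⋃ m ∈ Finset.range (n + 1), Q m := by
    ext a
    simp only [Set.mem_preimage, Set.mem_Iic, Set.mem_iUnion, Finset.mem_range, exists_prop]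
    constructor
    · intro h
      exact ⟨_, by omega, argmin_spec hN fun n => f n a⟩
    · rintro ⟨m, hm, hma⟩
      have : argmin N (fun n => f n a) ≤ m := Nat.sInf_le hma
      omega
  rw [this]
  exact Finset.measurableSet_biUnion _ fun m _ => hQm m

theorem measurable_score {D : ℕ} (N n : ℕ) {𝒳 : Type*} [MeasurableSpace 𝒳]
    {q : 𝒳 → (Fin D → ℝ) → ℝ≥0∞} (hq : Measurable (Function.uncurry q)) {c : 𝒳 → Fin D → ℝ}
    (hc : Measurable c) :
    Measurable fun p : 𝒳 × (ℕ → ℝ × (Fin D → ℝ)) =>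
      score N (c p.1) (q p.1) (fun m => (p.2 m).1) (fun m => (p.2 m).2) n := by
  have hcand : Measurable fun p : 𝒳 × (ℕ → ℝ × (Fin D → ℝ)) => candidate (c p.1) (p.2 n).2 := by
    have hpair : Measurable fun p : 𝒳 × (ℕ → ℝ × (Fin D → ℝ)) => (c p.1, (p.2 n).2) := by
      fun_prop
    have h := (measurable_candidate (D := D)).comp hpair
    simpa only [Function.comp_def] using h
  unfold score
  refine Measurable.mul ?_ (Measurable.div ?_ ?_)
  · unfold orderedTime
    exact ENNReal.measurable_ofReal.comp (Finset.measurable_fun_sum _ fun m _ =>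
      (measurable_fst.comp ((measurable_pi_apply m).comp measurable_snd)).const_mul _)
  · have hset : MeasurableSet {y : (Fin D → ℝ) × (Fin D → ℝ) | y.2 ∈ cell y.1} := by
      have : {y : (Fin D → ℝ) × (Fin D → ℝ) | y.2 ∈ cell y.1}
          = ⋂ i, ({y | y.1 i - 1 / 2 ≤ y.2 i} ∩ {y | y.2 i < y.1 i + 1 / 2}) := by
        ext y; simp [cell, Set.mem_pi]
      rw [this]
      exact MeasurableSet.iInter fun i => (measurableSet_le (by fun_prop) (by fun_prop)).inter
        (measurableSet_lt (by fun_prop) (by fun_prop))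
    have hind : Measurable ({y : (Fin D → ℝ) × (Fin D → ℝ) | y.2 ∈ cell y.1}.indicator
      (1 : (Fin D → ℝ) × (Fin D → ℝ) → ℝ≥0∞)) := measurable_one.indicator hset
    have h := hind.comp ((hc.comp measurable_fst).prodMk hcand)
    simpa only [Function.comp_def, Set.indicator, Set.mem_ofPred_eq, proposalDensity,
      Pi.one_apply] using h
  · exact hq.comp (measurable_fst.prodMk hcand)

theorem measurable_selectedIndex {D N : ℕ} (hN : 1 ≤ N) {𝒳 : Type*} [MeasurableSpace 𝒳]
    {q : 𝒳 → (Fin D → ℝ) → ℝ≥0∞} (hq : Measurable (Function.uncurry q)) {c : 𝒳 → Fin D → ℝ}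
    (hc : Measurable c) :
    Measurable fun p : 𝒳 × (ℕ → ℝ × (Fin D → ℝ)) =>
      selectedIndex N (c p.1) (q p.1) (fun m => (p.2 m).1) (fun m => (p.2 m).2) :=
  measurable_argmin hN fun n => measurable_score N n hq hc

theorem measurable_transmitted {D N : ℕ} (hN : 1 ≤ N) {𝒳 : Type*} [MeasurableSpace 𝒳]
    {q : 𝒳 → (Fin D → ℝ) → ℝ≥0∞} (hq : Measurable (Function.uncurry q)) {c : 𝒳 → Fin D → ℝ}
    (hc : Measurable c) :
    Measurable fun p : 𝒳 × (ℕ → ℝ × (Fin D → ℝ)) =>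
      transmitted N (c p.1) (q p.1) (fun m => (p.2 m).1) (fun m => (p.2 m).2) := by
  have hsel := measurable_selectedIndex hN hq hc
  refine hsel.prodMk ?_
  have h : Measurable fun r : ℕ × (𝒳 × (ℕ → ℝ × (Fin D → ℝ))) =>
      quantized (c r.2.1) (r.2.2 r.1).2 := by
    refine measurable_from_prod_countable_right fun n => ?_
    have hpair : Measurable fun p : 𝒳 × (ℕ → ℝ × (Fin D → ℝ)) => (c p.1, (p.2 n).2) := by
      fun_prop
    exact measurable_quantized.comp hpair
  exact h.comp (hsel.prodMk measurable_id)

/-! ### The choice of exponent and the entropy bound -/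

/-- The numerical estimate that turns the bound on `E log N*` into the bound on the entropy. -/
theorem coding_bound_lt {k : ℝ} (hk : 0 ≤ k) (L : ℝ) :
    (L + Real.log (1 + 1 / (1 / (k + 1)))) / Real.log 2
        + (1 + 1 / (k + 1)) / Real.log 2 * (k * Real.log 2 + Real.log 2)
      < k + L / Real.log 2 + Real.logb 2 (k + 1) + 4 := by
  have hlog2 : 0 < Real.log 2 := Real.log_pos one_lt_two
  -- With `s = 1 / (k + 1)`, the factor `1 + s = (k + 2) / (k + 1)` cancels against `k + 1`, leaving
  -- `k + 2` bits. The normalisation costs `log (k + 2)`, at most `log (k + 1)` plus one bit. The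
  -- overhead is thus at most 3, which makes the bound with 4 strict.
  have h1 : (1 + 1 / (k + 1)) / Real.log 2 * (k * Real.log 2 + Real.log 2) = k + 2 := by
    field_simp; ring
  have h2 : Real.log (1 + 1 / (1 / (k + 1))) ≤ Real.log (k + 1) + Real.log 2 := by
    rw [← Real.log_mul (by positivity) two_ne_zero]
    refine Real.log_le_log (by positivity) ?_
    rw [one_div_one_div]; linarith
  have h3 := div_le_div_of_nonneg_right h2 hlog2.le
  rw [add_div, div_self hlog2.ne'] at h3
  rw [h1, add_div, Real.logb]
  linarith

theorem ae_prod_quantized_mem_boxPoints {D : ℕ} {𝒳 : Type*} [MeasurableSpace 𝒳] {M : Fin D → ℕ}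
    {c : 𝒳 → Fin D → ℝ} (hc : Measurable c) (hc_box : ∀ x, cell (c x) ⊆ box M) (μ : Measure 𝒳) [SFinite μ] :
    ∀ᵐ p ∂(μ.prod (uniform (unitCube D))), quantized (c p.1) p.2 ∈ boxPoints M := by
  have hquant : Measurable fun p : 𝒳 × (Fin D → ℝ) => quantized (c p.1) p.2 := by
    have hpair : Measurable fun p : 𝒳 × (Fin D → ℝ) => (c p.1, p.2) := by fun_prop
    have h := (measurable_quantized (D := D)).comp hpair
    simpa only [Function.comp_def] using h
  have hm : MeasurableSet {p : 𝒳 × (Fin D → ℝ) | quantized (c p.1) p.2 ∈ boxPoints M} :=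
    hquant (boxPoints M).measurableSet
  rw [Measure.ae_prod_iff_ae_ae hm]
  filter_upwards with x
  exact ae_quantized_mem_boxPoints (hc_box x)

end HybridCoding

end

theorem theorem5
    {Ω 𝒳 : Type*} [MeasurableSpace Ω] [MeasurableSpace 𝒳]
    (P : Measure Ω) [IsProbabilityMeasure P]
    (D N : ℕ) (hN : 1 ≤ N)
    (M : Fin D → ℕ) (hM : ∀ i, 1 ≤ M i)
    -- the target densities `q_x` and the centres `c_x`
    (q : 𝒳 → (Fin D → ℝ) → ℝ≥0∞) (hq : Measurable (Function.uncurry q))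
    (hq_one : ∀ x, ∫⁻ z, q x z = 1)
    (c : 𝒳 → Fin D → ℝ) (hc : Measurable c)
    (hq_supp : ∀ x, ∀ᵐ z : Fin D → ℝ, z ∉ HybridCoding.cell (c x) → q x z = 0)
    (hc_box : ∀ x, HybridCoding.cell (c x) ⊆ HybridCoding.box M)
    -- the source `X`, the exponential variables `S_n` and the dithers `U_n`, all independent
    (X : Ω → 𝒳) (hX : Measurable X)
    (S : ℕ → Ω → ℝ) (hS : ∀ n, Measurable (S n)) (hS_law : ∀ n, P.map (S n) = expMeasure 1)
    (U : ℕ → Ω → Fin D → ℝ) (hU : ∀ n, Measurable (U n))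
    (hU_law : ∀ n, P.map (U n) = HybridCoding.uniform (HybridCoding.unitCube D))
    (h_indep_SU : ∀ n, IndepFun (S n) (U n) P)
    (h_indep_seq : iIndepFun (fun n ω => (S n ω, U n ω)) P)
    (h_indep_X : IndepFun X (fun ω n => (S n ω, U n ω)) P)
    -- `C` is the expected divergence in bits, assumed finite
    (hC_fin : ∫⁻ ω, HybridCoding.klBox M (q (X ω)) ∂P ≠ ∞)
    (C : ℝ) (hC : C = (∫⁻ ω, HybridCoding.klBox M (q (X ω)) ∂P).toReal / Real.log 2) :
    HybridCoding.entropy P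
        (fun ω => HybridCoding.transmitted N (c (X ω)) (q (X ω)) (fun n => S n ω) (fun n => U n ω))
      < ENNReal.ofReal
          (C + Real.logb 2 (C - ∑ i, Real.logb 2 (M i : ℝ) + 1) + 4) := by
  have hlog2 : 0 < Real.log 2 := Real.log_pos one_lt_two
  have hlaw : ∀ n, P.map (fun ω => (S n ω, U n ω))
      = (expMeasure 1).prod (HybridCoding.uniform (HybridCoding.unitCube D)) := fun n => by
    rw [(indepFun_iff_map_prod_eq_prod_map_map (hS n).aemeasurable (hU n).aemeasurable).1
      (h_indep_SU n), hS_law, hU_law]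
  have hqx : ∀ x, Measurable (q x) := fun x => hq.of_uncurry_left
  set Y : Ω → ℕ → ℝ × (Fin D → ℝ) := fun ω n => (S n ω, U n ω) with hY
  have hYm : Measurable Y := measurable_pi_lambda _ fun n => (hS n).prodMk (hU n)
  have hXY : P.map (fun ω => (X ω, Y ω)) = (P.map X).prod (P.map Y) :=
    (indepFun_iff_map_prod_eq_prod_map_map hX.aemeasurable hYm.aemeasurable).1 h_indep_X
  have : IsProbabilityMeasure (P.map Y) := Measure.isProbabilityMeasure_map hYm.aemeasurable
  have : IsProbabilityMeasure (P.map X) := Measure.isProbabilityMeasure_map hX.aemeasurable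
  set V : ℕ := ∏ i, M i with hV
  have hV1 : 1 ≤ V := Finset.one_le_prod' fun i _ => hM i
  have hlogV : 0 ≤ Real.log V := Real.log_natCast_nonneg V
  -- the divergence from the uniform distribution on the cell
  set κ : 𝒳 → ℝ≥0∞ := fun x => ∫⁻ z in HybridCoding.cell (c x),
    ENNReal.ofReal (InformationTheory.klFun (q x z).toReal) with hκ
  have hkl : ∫⁻ ω, HybridCoding.klBox M (q (X ω)) ∂P
      = (∫⁻ ω, κ (X ω) ∂P) + ENNReal.ofReal (Real.log V) := by
    simp_rw [HybridCoding.klBox_eq hM (hqx _) (hq_one _) (hq_supp _) (hc_box _)]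
    rw [lintegral_add_right _ measurable_const]
    simp [hκ, hV]
  have hκfin : ∫⁻ ω, κ (X ω) ∂P ≠ ∞ := fun h => hC_fin (by rw [hkl, h, top_add])
  -- In bits, `k` equals `C - ∑ log M i`, the quantity inside the logarithm of the final bound.
  set k : ℝ := (∫⁻ ω, κ (X ω) ∂P).toReal / Real.log 2 with hk
  have hk0 : 0 ≤ k := div_nonneg ENNReal.toReal_nonneg hlog2.le
  have hκk : ∫⁻ ω, κ (X ω) ∂P = ENNReal.ofReal (k * Real.log 2) := by
    rw [hk, div_mul_cancel₀ _ hlog2.ne', ENNReal.ofReal_toReal hκfin]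
  have hCk : C = k + Real.log V / Real.log 2 := by
    rw [hC, hkl, ENNReal.toReal_add hκfin ENNReal.ofReal_ne_top, ENNReal.toReal_ofReal hlogV,
      add_div]
  have hsumM : ∑ i, Real.logb 2 (M i : ℝ) = Real.log V / Real.log 2 := by
    rw [hV, Nat.cast_prod, Real.log_prod fun i _ => by
      have := hM i; exact_mod_cast (by omega : M i ≠ 0), Finset.sum_div]
    rfl
  -- the expected logarithm of the index
  have hselm := HybridCoding.measurable_selectedIndex hN hq hc
  have hlogN : ∫⁻ ω, ENNReal.ofReal (Real.log (HybridCoding.selectedIndex N (c (X ω)) (q (X ω))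
      (fun n => S n ω) (fun n => U n ω))) ∂P ≤ ENNReal.ofReal (k * Real.log 2 + Real.log 2) := by
    set f : 𝒳 × (ℕ → ℝ × (Fin D → ℝ)) → ℝ≥0∞ := fun p => ENNReal.ofReal (Real.log
      (HybridCoding.selectedIndex N (c p.1) (q p.1) (fun m => (p.2 m).1) (fun m => (p.2 m).2)))
      with hf
    have hfm : Measurable f := (measurable_of_countable
      (fun n : ℕ => ENNReal.ofReal (Real.log n))).comp hselm
    calc _ = ∫⁻ p, f p ∂(P.map fun ω => (X ω, Y ω)) := by
          rw [lintegral_map hfm (hX.prodMk hYm)]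
      -- Independence of `X` from the times and dithers reduces the estimate to a fixed target.
      _ = ∫⁻ x, ∫⁻ y, f (x, y) ∂(P.map Y) ∂(P.map X) := by
          rw [hXY, lintegral_prod _ hfm.aemeasurable]
      _ ≤ ∫⁻ x, (κ x + ENNReal.ofReal (Real.log 2)) ∂(P.map X) := by
          refine lintegral_mono fun x => ?_
          have hfx : Measurable fun y => f (x, y) := hfm.comp measurable_prodMk_left
          rw [lintegral_map hfx hYm]
          exact (HybridCoding.lintegral_log_selectedIndex_le P hN (hqx x) (hq_one x) (hq_supp x)
            hS hU hlaw h_indep_seq).trans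
            (HybridCoding.lintegral_mul_log_one_add_le (hqx x) (hq_one x) (c x))
      _ ≤ ∫⁻ ω, (κ (X ω) + ENNReal.ofReal (Real.log 2)) ∂P := lintegral_map_le _ _
      _ = _ := by
          rw [lintegral_add_right _ measurable_const, hκk, lintegral_const, measure_univ, mul_one,
            ← ENNReal.ofReal_add (by positivity) hlog2.le]
  -- the quantized values lie in the box
  have hbox : ∀ᵐ ω ∂P, ∀ n, HybridCoding.quantized (c (X ω)) (U n ω)
      ∈ HybridCoding.boxPoints M := by
    rw [ae_all_iff]
    intro n
    have hind : IndepFun X (U n) P := h_indep_X.comp (φ := id)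
      (ψ := fun y : ℕ → ℝ × (Fin D → ℝ) => (y n).2) measurable_id (by fun_prop)
    have h1 : ∀ᵐ p ∂(P.map fun ω => (X ω, U n ω)),
        HybridCoding.quantized (c p.1) p.2 ∈ HybridCoding.boxPoints M := by
      rw [(indepFun_iff_map_prod_eq_prod_map_map hX.aemeasurable (hU n).aemeasurable).1 hind,
        hU_law]
      exact HybridCoding.ae_prod_quantized_mem_boxPoints hc hc_box _
    filter_upwards [ae_of_ae_map (hX.prodMk (hU n)).aemeasurable h1] with ω h using h
  have htm : Measurable fun ω => HybridCoding.transmitted N (c (X ω)) (q (X ω))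
      (fun n => S n ω) (fun n => U n ω) := by
    have h := (HybridCoding.measurable_transmitted hN hq hc).comp (hX.prodMk hYm)
    simpa only [Function.comp_def, hY] using h
  have hcard : (HybridCoding.boxPoints M).card = V := HybridCoding.card_boxPoints M
  have hne : (HybridCoding.boxPoints M).Nonempty := by
    rw [← Finset.card_pos, hcard]; omega
  have hbox' : ∀ᵐ ω ∂P, (HybridCoding.transmitted N (c (X ω)) (q (X ω)) (fun n => S n ω)
      (fun n => U n ω)).2 ∈ HybridCoding.boxPoints M := by
    filter_upwards [hbox] with ω h
    -- Membership holds almost surely for all `n` at once, hence at the random index.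
    exact h (HybridCoding.selectedIndex N (c (X ω)) (q (X ω)) (fun n => S n ω) fun n => U n ω)
  have hone : ∀ ω, 1 ≤ (HybridCoding.transmitted N (c (X ω)) (q (X ω)) (fun n => S n ω)
      (fun n => U n ω)).1 := fun ω => (Finset.mem_Icc.1 (HybridCoding.argmin_spec hN _).1).1
  have hH := HybridCoding.entropy_le_of_lintegral_log P htm
    hone _ hne hbox' (s := 1 / (k + 1)) (by positivity)
  refine hH.trans_lt ?_
  rw [hcard]
  have hb := HybridCoding.coding_bound_lt hk0 (Real.log V)
  have hlog_pos : 0 ≤ Real.log (1 + 1 / (1 / (k + 1))) :=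
    Real.log_nonneg (by rw [one_div_one_div]; linarith)
  have hA : 0 ≤ (Real.log V + Real.log (1 + 1 / (1 / (k + 1)))) / Real.log 2 := by positivity
  have hB : 0 ≤ (1 + 1 / (k + 1)) / Real.log 2 := by positivity
  have hE : 0 ≤ k * Real.log 2 + Real.log 2 := by positivity
  calc _ ≤ ENNReal.ofReal ((Real.log V + Real.log (1 + 1 / (1 / (k + 1)))) / Real.log 2)
        + ENNReal.ofReal ((1 + 1 / (k + 1)) / Real.log 2)
          * ENNReal.ofReal (k * Real.log 2 + Real.log 2) := by
        gcongr
        exact hlogN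
    _ < _ := by
        rw [← ENNReal.ofReal_mul hB, ← ENNReal.ofReal_add hA (mul_nonneg hB hE), hsumM, hCk,
          add_sub_cancel_right]
        exact (ENNReal.ofReal_lt_ofReal_iff_of_nonneg (add_nonneg hA (mul_nonneg hB hE))).2 hb
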